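/- For $g\ge 2$ let \[\Gamma_g=\big\langle a_1,b_1,\dots,a_g,b_g \;\big|\; [a_1,b_1]\cdots[a_g,b_g]=1\big\rangle\] be the fundamental group of the closed orientable surface of genus $g$, with the symmetric generating set $S=\{a_1^{\pm1},b_1^{\pm1},\dots,a_g^{\pm1},b_g^{\pm1}\}$ of standard generators. Let $M_g:\ell^2(\Gamma_g)\to\ell^2(\Gamma_g)$ be the Markov operator of the simple random walk, \[(M_gf)(\gamma)=\frac1{\# S}\sum_{s\in S}f(\gamma s),\] and let $\|M_g\|$, the spectral radius, be its operator norm. Then \[0.662418\le\|M_2\|\le 0.662816\qquad\text{and}\qquad 0.552773\le\|M_3\|\le 0.552792.\] -/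

import Mathlib

open scoped ENNReal

noncomputable section

namespace SurfaceWalk

/-- The Hilbert space `ℓ²(Γ)` of square-summable complex functions on `Γ`. -/
abbrev EllTwo (Γ : Type*) : Type _ := lp (fun _ : Γ => ℂ) 2

section Markov

variable {Γ : Type*} [Group Γ]

theorem memEllTwo_translate (s : Γ) (f : EllTwo Γ) :
    Memℓp (fun γ : Γ => f (γ * s)) 2 := by
  have h2 : 0 < (2 : ℝ≥0∞).toReal := by norm_num
  exact (memℓp_gen_iff h2).2
    ((Equiv.mulRight s).summable_iff.2 ((memℓp_gen_iff h2).1 (lp.memℓp f)))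

/-- Right translation by `s` on `ℓ²(Γ)`: it sends `f` to `γ ↦ f (γ s)`. -/
def translate (s : Γ) : EllTwo Γ →ₗᵢ[ℂ] EllTwo Γ where
  toFun f := ⟨fun γ => f (γ * s), memEllTwo_translate s f⟩
  map_add' _ _ := rfl
  map_smul' _ _ := rfl
  norm_map' f := by
    have h2 : 0 < (2 : ℝ≥0∞).toReal := by norm_num
    rw [lp.norm_eq_tsum_rpow h2, lp.norm_eq_tsum_rpow h2 f]
    congr 1
    exact (Equiv.mulRight s).tsum_eq (fun γ => ‖f γ‖ ^ (2 : ℝ≥0∞).toReal)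

/-- The Markov operator `M` on `ℓ²(Γ)` of the simple random walk on `Γ` with respect to the finite
set `S`. -/
def markovOperator (S : Finset Γ) : EllTwo Γ →L[ℂ] EllTwo Γ :=
  (S.card : ℂ)⁻¹ • ∑ s ∈ S, (translate s).toContinuousLinearMap

/-- The defining formula `(M f)(γ) = (1 / #S) ∑_{s ∈ S} f (γ s)`. -/
theorem markovOperator_apply (S : Finset Γ) (f : EllTwo Γ) (γ : Γ) :
    markovOperator S f γ = 1 / (S.card : ℂ) * ∑ s ∈ S, f (γ * s) := by
  have h : ∀ T : Finset Γ,
      (((∑ s ∈ T, (translate s).toContinuousLinearMap) f : EllTwo Γ) : Γ → ℂ) γ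
        = ∑ s ∈ T, f (γ * s) := by
    intro T
    rw [_root_.sum_apply, lp.coeFn_sum, Finset.sum_apply]
    rfl
  rw [one_div, ← h S]
  rfl

end Markov

/-- The index set of the `2g` generators: `Sum.inl i` stands for `a_i`, `Sum.inr i` for `b_i`. -/
abbrev Gen (g : ℕ) : Type := Fin g ⊕ Fin g

/-- The word `[a_1, b_1] ⋯ [a_g, b_g]` in the free group, with `[a, b] = a b a⁻¹ b⁻¹`. -/
def surfaceRelator (g : ℕ) : FreeGroup (Gen g) :=
  (List.ofFn fun i : Fin g =>
    FreeGroup.of (Sum.inl i : Gen g) * FreeGroup.of (Sum.inr i : Gen g) *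
      (FreeGroup.of (Sum.inl i : Gen g))⁻¹ * (FreeGroup.of (Sum.inr i : Gen g))⁻¹).prod

/-- The surface group `Γ_g = ⟨a_1, b_1, …, a_g, b_g | [a_1, b_1] ⋯ [a_g, b_g] = 1⟩`. -/
abbrev SurfaceGroup (g : ℕ) : Type := PresentedGroup ({surfaceRelator g} : Set (FreeGroup (Gen g)))

open scoped Classical in
/-- The standard symmetric generating set: the images in `Γ_g` of the `a_i`, the `b_i` and their
inverses. -/
def standardGenerators (g : ℕ) : Finset (SurfaceGroup g) :=
  Finset.univ.image (fun x : Gen g => (PresentedGroup.of x : SurfaceGroup g)) ∪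
    Finset.univ.image (fun x : Gen g => (PresentedGroup.of x : SurfaceGroup g)⁻¹)

/-- The Markov operator `M_g` of the surface group of genus `g` with its standard generators. -/
def surfaceMarkov (g : ℕ) : EllTwo (SurfaceGroup g) →L[ℂ] EllTwo (SurfaceGroup g) :=
  markovOperator (standardGenerators g)

end SurfaceWalk

end

/-! Write `k = 4g` and `m = 2g`. Both bounds come from positive functions on the Cayley graph, which
is the 1-skeleton of a tiling by `k`-gons, `k` at each vertex.

Upper bound: in Schur's test, positive weights on the oriented edges, reciprocal on opposite
orientations and of sum at most `Λ` at each vertex, give `‖M‖ ≤ Λ / k`. Let the group act by side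
pairings on the hyperbolic plane tiled by regular `k`-gons of angle `π / m`; the Cayley graph is
dual to this tiling. The sides lie on full lines, the walls, with `m` of them through each vertex.
An edge is weighted by whether it crosses its wall towards a generic base point, and by how many
walls through the ends of the crossed side separate the tile from that point. Lines of non-adjacent
sides are disjoint, so few local configurations occur (`sum_edgeWeight_le`), and a handful of
numerical inequalities suffices. Only a homomorphism with the right values on generators is used,
not its faithfulness or discreteness (`norm_markovOperator_le_of_polygon`).

Lower bound: if `‖M‖ < lam`, the Green function at `lam` is a positive `h` with `M h ≤ lam h`. Let
`c` and `c'` be the infima of the sums of `h` over `k - 2` and `k - 3` consecutive neighbours,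
divided by the value at the centre. On the boundary of a face, each vertex has `k - 2` neighbours
outside the two adjacent ones, so there `h` satisfies a one-dimensional inequality with constant `k
lam - c`. Arithmetic-geometric estimates along the arcs (`path_ratio_le`), added up around a vertex
(`fan_sum_ge`), bound `c` and `c'` below by affine functions of themselves. For the stated values of
`lam` this linear system has no solution. -/

noncomputable section

namespace SurfaceWalk

/-! ### Schur's test with edge weights -/

section OperatorBounds

variable {Γ : Type*}

theorem ellTwo_hasSum_norm_sq (f : EllTwo Γ) : HasSum (fun γ => ‖f γ‖ ^ 2) (‖f‖ ^ 2) := by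
  have h := lp.hasSum_norm (p := 2) (by norm_num) f
  simpa using h

theorem ellTwo_norm_le_of_hasSum {f : EllTwo Γ} {b c : ℝ} (hb : 0 ≤ b) {u : Γ → ℝ}
    (hu : HasSum u c) (hc : c ≤ b ^ 2) (h : ∀ γ, ‖f γ‖ ^ 2 ≤ u γ) : ‖f‖ ≤ b := by
  have := hasSum_le h (ellTwo_hasSum_norm_sq f) hu
  exact abs_le_of_sq_le_sq' (this.trans hc) hb |>.2

/-- Evaluation at a point, as a continuous linear functional on `ℓ²`. -/
def ellTwoEval (γ : Γ) : EllTwo Γ →L[ℂ] ℂ :=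
  LinearMap.mkContinuous
    { toFun := fun f => f γ, map_add' := fun _ _ => rfl, map_smul' := fun _ _ => rfl } 1
    (fun f => by
      rw [one_mul]
      exact lp.norm_apply_le_norm (p := 2) (by norm_num) f γ)

variable [Group Γ] {ι : Type*} [Fintype ι] {S : Finset Γ} {s : ι → Γ}

theorem markovOperator_apply_eq_sum (hS : ∀ F : Γ → ℂ, ∑ x ∈ S, F x = ∑ i, F (s i))
    (hc : S.card = Fintype.card ι) (f : EllTwo Γ) (γ : Γ) :
    markovOperator S f γ = (Fintype.card ι : ℂ)⁻¹ * ∑ i, f (γ * s i) := by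
  rw [markovOperator_apply, hc, one_div, hS (fun x => f (γ * x))]

set_option maxHeartbeats 1000000 in
/-- Schur's test for the Markov operator, in the edge-weight form of Gabber and Galil. -/
theorem norm_markovOperator_le_of_edge_weight
    (hS : ∀ F : Γ → ℂ, ∑ x ∈ S, F x = ∑ i, F (s i)) (hc : S.card = Fintype.card ι)
    (inv : ι ≃ ι) (F : Γ → ι → ℝ) (hF : ∀ γ i, 0 < F γ i)
    (hFF : ∀ γ i, F γ i * F (γ * s i) (inv i) = 1) {Λ : ℝ} (hΛ0 : 0 ≤ Λ)
    (hΛ : ∀ γ, ∑ i, F γ i ≤ Λ) : ‖markovOperator S‖ ≤ Λ / Fintype.card ι := by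
  have hk : (0 : ℝ) ≤ Fintype.card ι := Nat.cast_nonneg _
  refine ContinuousLinearMap.opNorm_le_bound _ (div_nonneg hΛ0 hk) fun f => ?_
  have hle : ∀ γ i, F γ i ≤ Λ := fun γ i =>
    (Finset.single_le_sum (fun j _ => (hF γ j).le) (Finset.mem_univ i)).trans (hΛ γ)
  have hsum : ∀ i, Summable fun γ => F γ i * ‖f γ‖ ^ 2 := fun i =>
    Summable.of_nonneg_of_le (fun γ => mul_nonneg (hF γ i).le (sq_nonneg _))
      (fun γ => mul_le_mul_of_nonneg_right (hle γ i) (sq_nonneg _))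
      ((ellTwo_hasSum_norm_sq f).summable.mul_left Λ)
  have htot : ∑ i, ∑' γ, F γ i * ‖f γ‖ ^ 2 ≤ Λ * ‖f‖ ^ 2 := by
    have h1 : HasSum (fun γ => ∑ i, F γ i * ‖f γ‖ ^ 2) (∑ i, ∑' γ, F γ i * ‖f γ‖ ^ 2) :=
      hasSum_sum fun i _ => (hsum i).hasSum
    refine hasSum_le (fun γ => ?_) h1 ((ellTwo_hasSum_norm_sq f).mul_left Λ)
    rw [← Finset.sum_mul]
    exact mul_le_mul_of_nonneg_right (hΛ γ) (sq_nonneg _)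
  have hshift : ∀ i, HasSum (fun γ => F (γ * s i) (inv i) * ‖f (γ * s i)‖ ^ 2)
      (∑' γ, F γ (inv i) * ‖f γ‖ ^ 2) := fun i =>
    (Equiv.mulRight (s i)).hasSum_iff.2 (hsum (inv i)).hasSum
  have hu := (hasSum_sum fun i (_ : i ∈ Finset.univ) => hshift i).mul_left
    (Λ * ((Fintype.card ι : ℝ)⁻¹) ^ 2)
  refine ellTwo_norm_le_of_hasSum (mul_nonneg (div_nonneg hΛ0 hk) (norm_nonneg _)) hu ?_ ?_
  · rw [Equiv.sum_comp inv (fun i => ∑' γ, F γ i * ‖f γ‖ ^ 2)]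
    calc _ ≤ Λ * ((Fintype.card ι : ℝ)⁻¹) ^ 2 * (Λ * ‖f‖ ^ 2) :=
          mul_le_mul_of_nonneg_left htot (by positivity)
      _ = _ := by rw [div_eq_mul_inv]; ring
  · intro γ
    rw [markovOperator_apply_eq_sum hS hc, norm_mul, mul_pow, norm_inv, Complex.norm_natCast,
      mul_comm Λ, mul_assoc]
    refine mul_le_mul_of_nonneg_left ?_ (by positivity)
    -- Cauchy–Schwarz, splitting each term by the reciprocal weights `F γ i` and `F (γ * s i) (inv
    -- i)`. Summed over `γ` and translated, the second factor is `htot` reindexed by `inv`.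
    have hcs := Finset.sum_sq_le_sum_mul_sum_of_sq_le_mul Finset.univ (r := fun i => ‖f (γ * s i)‖)
      (f := fun i => F γ i) (g := fun i => F (γ * s i) (inv i) * ‖f (γ * s i)‖ ^ 2)
      (fun i _ => (hF γ i).le) (fun i _ => mul_nonneg (hF _ _).le (sq_nonneg _))
      (fun i _ => by rw [← mul_assoc, hFF, one_mul])
    calc ‖∑ i, f (γ * s i)‖ ^ 2 ≤ (∑ i, ‖f (γ * s i)‖) ^ 2 :=
          pow_le_pow_left₀ (norm_nonneg _) (norm_sum_le _ _) 2
      _ ≤ _ := hcs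
      _ ≤ _ := mul_le_mul_of_nonneg_right (hΛ γ)
          (Finset.sum_nonneg fun i _ => mul_nonneg (hF _ _).le (sq_nonneg _))

end OperatorBounds

/-! ### Positive superharmonic functions from the Green function -/

section OperatorBounds

variable {Γ : Type*}

/-- The Neumann series `∑ Tⁿ δ` converges in norm, and each of its terms has nonnegative real part.
-/
theorem exists_nonneg_eq_add_apply {T : EllTwo Γ →L[ℂ] EllTwo Γ} (hT : ‖T‖ < 1)
    (hpos : ∀ f : EllTwo Γ, (∀ γ, 0 ≤ (f γ).re) → ∀ γ, 0 ≤ (T f γ).re) (δ : EllTwo Γ)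
    (hδ : ∀ γ, 0 ≤ (δ γ).re) : ∃ G : EllTwo Γ, G = δ + T G ∧ ∀ γ, 0 ≤ (G γ).re := by
  have hs : HasSum (fun n : ℕ => T ^ n) (∑' n : ℕ, T ^ n) :=
    (summable_geometric_of_norm_lt_one hT).hasSum
  have hpow : ∀ n γ, 0 ≤ ((T ^ n) δ γ).re := by
    intro n
    induction n with
    | zero => simpa using hδ
    | succ n ih =>
      intro γ
      rw [pow_succ', mul_apply_eq_comp]
      exact hpos _ ih γ
  refine ⟨(∑' n : ℕ, T ^ n) δ, ?_, fun γ => ?_⟩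
  · have h := mul_neg_geom_series T hT
    rw [sub_mul, one_mul, sub_eq_iff_eq_add] at h
    conv_lhs => rw [h]
    rw [add_apply, mul_apply_eq_comp, one_apply_eq_self]
  · have h1 : HasSum (fun n : ℕ => (T ^ n) δ) ((∑' n : ℕ, T ^ n) δ) :=
      (ContinuousLinearMap.apply ℂ (EllTwo Γ) δ).hasSum hs
    have h2 : HasSum (fun n : ℕ => (T ^ n) δ γ) ((∑' n : ℕ, T ^ n) δ γ) :=
      (ellTwoEval γ).hasSum h1
    exact (Complex.hasSum_re h2).nonneg fun n => hpow n γ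

variable [Group Γ] {ι : Type*} [Fintype ι] {S : Finset Γ} {s : ι → Γ}

theorem re_markovOperator_apply (hS : ∀ F : Γ → ℂ, ∑ x ∈ S, F x = ∑ i, F (s i))
    (hc : S.card = Fintype.card ι) (f : EllTwo Γ) (γ : Γ) :
    (markovOperator S f γ).re = (Fintype.card ι : ℝ)⁻¹ * ∑ i, (f (γ * s i)).re := by
  rw [markovOperator_apply_eq_sum hS hc, ← Complex.ofReal_natCast, ← Complex.ofReal_inv,
    Complex.re_ofReal_mul, Complex.re_sum]

/-- If the norm of the Markov operator of a generating family is less than `lam`, then there is a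
positive `lam`-superharmonic function. -/
theorem exists_superharmonic_of_norm_markovOperator_lt [Nonempty ι]
    (hS : ∀ F : Γ → ℂ, ∑ x ∈ S, F x = ∑ i, F (s i)) (hc : S.card = Fintype.card ι)
    (inv : ι → ι) (hinv : ∀ i, s (inv i) = (s i)⁻¹)
    (hgen : Subgroup.closure (Set.range s) = ⊤) {lam : ℝ} (hlam : ‖markovOperator S‖ < lam) :
    ∃ h : Γ → ℝ, (∀ γ, 0 < h γ) ∧
      ∀ γ, ∑ i, h (γ * s i) ≤ Fintype.card ι * lam * h γ := by
  classical
  have hk : (0 : ℝ) < Fintype.card ι := Nat.cast_pos.2 Fintype.card_pos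
  have hl : 0 < lam := (norm_nonneg _).trans_lt hlam
  have hTn : ‖((lam⁻¹ : ℝ) : ℂ) • markovOperator S‖ < 1 := by
    rw [norm_smul, Complex.norm_real, Real.norm_of_nonneg (by positivity), inv_mul_lt_one₀ hl]
    exact hlam
  have hTa : ∀ (f : EllTwo Γ) γ, (((((lam⁻¹ : ℝ) : ℂ) • markovOperator S) f : EllTwo Γ) γ).re =
      lam⁻¹ * (Fintype.card ι : ℝ)⁻¹ * ∑ i, (f (γ * s i)).re := fun f γ => by
    rw [smul_apply, lp.coeFn_smul, Pi.smul_apply, smul_eq_mul, Complex.re_ofReal_mul,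
      re_markovOperator_apply hS hc, mul_assoc]
  obtain ⟨δ, hdelta, hdelta_one⟩ : ∃ δ : EllTwo Γ, (∀ γ, 0 ≤ (δ γ).re) ∧ (δ 1).re = 1 := by
    refine ⟨lp.single 2 (1 : Γ) (1 : ℂ), fun γ => ?_, by simp⟩
    rw [lp.single_apply, Pi.single_apply]
    split_ifs <;> simp
  obtain ⟨G, hG, hGpos⟩ := exists_nonneg_eq_add_apply hTn (fun f hf γ => by
    rw [hTa]
    exact mul_nonneg (by positivity) (Finset.sum_nonneg fun i _ => hf _))
    δ hdelta
  have hGM : ∀ γ, (G γ).re = (δ γ).re +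
      lam⁻¹ * (Fintype.card ι : ℝ)⁻¹ * ∑ i, (G (γ * s i)).re := fun γ => by
    rw [← hTa, ← Complex.add_re]
    exact congrArg (fun f : EllTwo Γ => (f γ).re) hG
  clear hG hTa hTn
  generalize hg : (fun γ => (G γ).re) = g at *
  have hg' : ∀ γ, (G γ).re = g γ := fun γ => congrFun hg γ
  simp only [hg'] at hGM hGpos
  have hsuper : ∀ γ, ∑ i, g (γ * s i) ≤ Fintype.card ι * lam * g γ := fun γ => by
    have h1 := hGM γ
    have h2 : Fintype.card ι * lam * (lam⁻¹ * (Fintype.card ι : ℝ)⁻¹ * ∑ i, g (γ * s i)) =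
        ∑ i, g (γ * s i) := by
      field_simp
    rw [h1, mul_add, h2]
    have := mul_nonneg (mul_pos hk hl).le (hdelta γ)
    linarith
  have hone : 0 < g 1 := by
    have := hGM 1
    rw [hdelta_one] at this
    have h2 : 0 ≤ lam⁻¹ * (Fintype.card ι : ℝ)⁻¹ * ∑ i, g (1 * s i) :=
      mul_nonneg (by positivity) (Finset.sum_nonneg fun i _ => hGpos _)
    linarith
  -- At a zero of `g`, superharmonicity forces all neighbours to vanish; so positivity at `1`
  -- spreads along the generators.
  have hstep : ∀ γ i, 0 < g (γ * s i) → 0 < g γ := fun γ i h => by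
    have h1 : g (γ * s i) ≤ ∑ i, g (γ * s i) :=
      Finset.single_le_sum (f := fun i => g (γ * s i)) (fun j _ => hGpos _) (Finset.mem_univ i)
    have h2 := hsuper γ
    by_contra h3
    have h4 : g γ = 0 := le_antisymm (not_lt.1 h3) (hGpos γ)
    rw [h4, mul_zero] at h2
    linarith
  refine ⟨g, fun γ => ?_, hsuper⟩
  have hmem : γ ∈ Subgroup.closure (Set.range s) := hgen ▸ Subgroup.mem_top γ
  refine Subgroup.closure_induction_right (p := fun x _ => 0 < g x) hone ?_ ?_ hmem
  · rintro x _ _ ⟨i, rfl⟩ hx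
    refine hstep (x * s i) (inv i) ?_
    rwa [hinv, mul_inv_cancel_right]
  · rintro x _ _ ⟨i, rfl⟩ hx
    refine hstep _ i ?_
    rwa [inv_mul_cancel_right]

end OperatorBounds

/-! ### Lower bound: superharmonic functions along faces -/

section LowerBound

theorem sum_zmod_eq_sum_range {k : ℕ} [NeZero k] {M : Type*} [AddCommMonoid M] (f : ZMod k → M)
    (d : ZMod k) : ∑ i, f i = ∑ m ∈ Finset.range k, f (d + m) := by
  rw [← Equiv.sum_comp (Equiv.addLeft d)]
  refine Finset.sum_bij' (fun i _ => i.val) (fun m _ => (m : ZMod k)) ?_ ?_ ?_ ?_ ?_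
  · intro i _
    exact Finset.mem_range.2 (ZMod.val_lt i)
  · intro m _
    exact Finset.mem_univ _
  · intro i _
    exact ZMod.natCast_zmod_val i
  · intro m hm
    exact ZMod.val_cast_of_lt (Finset.mem_range.1 hm)
  · intro i _
    rw [ZMod.natCast_zmod_val, Equiv.coe_addLeft]

/-- An arithmetic-geometric mean estimate along a path on which `h` is superharmonic. -/
theorem path_ratio_le {μ : ℝ} {h : ℕ → ℝ} (hpos : ∀ m, 0 < h m)
    (hs : ∀ m, h m + h (m + 2) ≤ μ * h (m + 1)) (e : ℕ → ℝ) (n : ℕ) :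
    2 * ∑ m ∈ Finset.range (n + 1), e m * e (m + 1) - μ * ∑ m ∈ Finset.range n, e (m + 1) ^ 2 ≤
      e 0 ^ 2 * (h 1 / h 0) + e (n + 1) ^ 2 * (h n / h (n + 1)) := by
  have amgm : ∀ m, 2 * (e m * e (m + 1)) ≤
      e m ^ 2 * (h (m + 1) / h m) + e (m + 1) ^ 2 * (h m / h (m + 1)) := fun m => by
    have h1 := hpos m
    have h2 := hpos (m + 1)
    have : e m ^ 2 * (h (m + 1) / h m) + e (m + 1) ^ 2 * (h m / h (m + 1)) - 2 * (e m * e (m + 1))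
        = (e m * h (m + 1) - e (m + 1) * h m) ^ 2 / (h m * h (m + 1)) := by
      field_simp
      ring
    have h3 : 0 ≤ (e m * h (m + 1) - e (m + 1) * h m) ^ 2 / (h m * h (m + 1)) := by positivity
    linarith
  induction n with
  | zero => simpa using amgm 0
  | succ n ih =>
    rw [Finset.sum_range_succ _ (n + 1), Finset.sum_range_succ (fun m => e (m + 1) ^ 2) n]
    have h1 := amgm (n + 1)
    have h2 : e (n + 1) ^ 2 * (h n / h (n + 1)) + e (n + 1) ^ 2 * (h (n + 1 + 1) / h (n + 1)) ≤
        μ * e (n + 1) ^ 2 := by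
      rw [← mul_add, mul_comm μ, ← add_div]
      refine mul_le_mul_of_nonneg_left ?_ (sq_nonneg _)
      rw [div_le_iff₀ (hpos _)]
      exact hs n
    linarith

variable {Γ : Type*} [Group Γ]

/-- The vertices met when walking from `γ` in direction `i` and turning always in the same way. -/
def facePath {k : ℕ} (s : ZMod k → Γ) (inv : ZMod k → ZMod k) (γ : Γ) (i : ZMod k) : ℕ → Γ
  | 0 => γ
  | m + 1 => facePath s inv γ i m * s ((fun j => inv j - 1)^[m] i)

/-- A family of elements of a group indexed by the cyclic order of the edges at a vertex of a
planar Cayley complex all of whose faces are `k`-gons, `k` being also the degree. -/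
structure IsCyclicOrder {k : ℕ} (s : ZMod k → Γ) (inv : ZMod k → ZMod k) : Prop where
  invol : ∀ i, inv (inv i) = i
  map_inv : ∀ i, s (inv i) = (s i)⁻¹
  facePath_eq : ∀ γ i, facePath s inv γ i k = γ
  inv_iterate : ∀ i, inv ((fun j => inv j - 1)^[k - 1] i) = i + 1

variable {q : ℕ} {s : ZMod (q + 5) → Γ} {inv : ZMod (q + 5) → ZMod (q + 5)} {h : Γ → ℝ} {Λ c c' : ℝ}

theorem sum_eq_add_sum_range_add_two (f : ZMod (q + 5) → ℝ) (b : ZMod (q + 5)) :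
    ∑ i, f i = ∑ m ∈ Finset.range (q + 3), f (b + 1 + m) + f (b - 1) + f b := by
  have h0 : ((q + 5 : ℕ) : ZMod (q + 5)) = 0 := ZMod.natCast_self _
  have h1 : b + 1 + ((q + 3 : ℕ) : ZMod (q + 5)) = b - 1 := by
    push_cast at h0 ⊢; linear_combination h0
  have h2 : b + 1 + ((q + 4 : ℕ) : ZMod (q + 5)) = b := by
    push_cast at h0 ⊢; linear_combination h0
  rw [sum_zmod_eq_sum_range f (b + 1), Finset.sum_range_succ, Finset.sum_range_succ, h1, h2]

theorem sum_eq_add_sum_range_add_three (f : ZMod (q + 5) → ℝ) (b : ZMod (q + 5)) :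
    ∑ i, f i = ∑ m ∈ Finset.range (q + 2), f (b + 2 + m) + f (b - 1) + f b + f (b + 1) := by
  have h0 : ((q + 5 : ℕ) : ZMod (q + 5)) = 0 := ZMod.natCast_self _
  have h1 : b + 2 + ((q + 2 : ℕ) : ZMod (q + 5)) = b - 1 := by
    push_cast at h0 ⊢; linear_combination h0
  have h2 : b + 2 + ((q + 3 : ℕ) : ZMod (q + 5)) = b := by
    push_cast at h0 ⊢; linear_combination h0
  have h3 : b + 2 + ((q + 4 : ℕ) : ZMod (q + 5)) = b + 1 := by
    push_cast at h0 ⊢; linear_combination h0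
  rw [sum_zmod_eq_sum_range f (b + 2), Finset.sum_range_succ, Finset.sum_range_succ,
    Finset.sum_range_succ, h1, h2, h3]

/-- The two path neighbours of a vertex lie in consecutive directions `b - 1` and `b`. The remaining
`q + 3` directions are consecutive too, and absorb at least `c` of the constant. -/
theorem face_superharmonic (hs : IsCyclicOrder s inv)
    (hsup : ∀ γ, ∑ i, h (γ * s i) ≤ Λ * h γ)
    (hc : ∀ γ d, c * h γ ≤ ∑ m ∈ Finset.range (q + 3), h (γ * s (d + m))) (γ : Γ) (i : ZMod (q + 5))
    (m : ℕ) : h (facePath s inv γ i m) + h (facePath s inv γ i (m + 2)) ≤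
      (Λ - c) * h (facePath s inv γ i (m + 1)) := by
  set v := facePath s inv γ i (m + 1) with hv
  set b := inv ((fun j => inv j - 1)^[m] i) with hb
  have h1 : facePath s inv γ i m = v * s b := by
    rw [hv, hb, hs.map_inv, facePath, mul_inv_cancel_right]
  have h2 : facePath s inv γ i (m + 2) = v * s (b - 1) := by
    rw [facePath, Function.iterate_succ_apply']
  have h3 := hsup v
  rw [sum_eq_add_sum_range_add_two _ b] at h3
  have h4 := hc v (b + 1)
  rw [h1, h2]
  linarith

/-- The face between the directions `i` and `i + 1` returns through `γ * s (i + 1)`, so the arc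
opposite `γ` joins two consecutive neighbours of `γ`. -/
theorem facePath_last (hs : IsCyclicOrder s inv) (γ : Γ) (i : ZMod (q + 5)) :
    facePath s inv γ i (q + 4) = γ * s (i + 1) ∧
      facePath s inv γ i (q + 3) = γ * s (i + 1) * s (inv (i + 1) + 1) := by
  have h1 : facePath s inv γ i (q + 4) = γ * s (i + 1) := by
    have := hs.facePath_eq γ i
    rw [facePath] at this
    have h2 := hs.inv_iterate i
    rw [show q + 5 - 1 = q + 4 from rfl] at h2
    rw [← h2, hs.map_inv]
    exact eq_mul_inv_of_mul_eq this
  refine ⟨h1, ?_⟩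
  have h2 := hs.inv_iterate i
  rw [show q + 5 - 1 = q + 3 + 1 from rfl, Function.iterate_succ_apply'] at h2
  have h3 : facePath s inv γ i (q + 4) =
      facePath s inv γ i (q + 3) * s ((fun j => inv j - 1)^[q + 3] i) := rfl
  rw [← h1, ← h2, hs.invol, sub_add_cancel, hs.map_inv, h3, mul_inv_cancel_right]

/-- The estimate for the sum of `h` over consecutive neighbours of a vertex obtained from the faces
between them. -/
theorem fan_sum_ge (hs : IsCyclicOrder s inv) (hpos : ∀ γ, 0 < h γ)
    (hsup : ∀ γ, ∑ i, h (γ * s i) ≤ Λ * h γ)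
    (hc : ∀ γ d, c * h γ ≤ ∑ m ∈ Finset.range (q + 3), h (γ * s (d + m)))
    (hc' : ∀ γ d, c' * h γ ≤ ∑ m ∈ Finset.range (q + 2), h (γ * s (d + m)))
    (e : ℕ → ℝ) (he : e (q + 3) = e 0) (n : ℕ) (γ : Γ) (d : ZMod (q + 5)) :
    2 * (n + 2) * e 0 - e 0 ^ 2 * (2 * (Λ - c) + n * (Λ - c')) +
      (n + 1) * (2 * ∑ m ∈ Finset.range (q + 3), e m * e (m + 1) -
        (Λ - c) * ∑ m ∈ Finset.range (q + 2), e (m + 1) ^ 2) ≤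
      (∑ m ∈ Finset.range (n + 2), h (γ * s (d + m))) / h γ := by
  set A := 2 * ∑ m ∈ Finset.range (q + 3), e m * e (m + 1) -
        (Λ - c) * ∑ m ∈ Finset.range (q + 2), e (m + 1) ^ 2 with hA
  set L : ZMod (q + 5) → ℝ := fun i => h (γ * s i * s (inv i - 1)) / h (γ * s i) with hL
  set R : ZMod (q + 5) → ℝ := fun i => h (γ * s i * s (inv i + 1)) / h (γ * s i) with hR
  set y : ZMod (q + 5) → ℝ := fun i => h γ / h (γ * s i) with hy
  -- The arc runs from `γ * s i` to `γ * s (i + 1)`, with `q + 2` interior vertices. `L` and `R` are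
  -- the ratios on its first and last edges.
  have harc : ∀ i, A ≤ e 0 ^ 2 * L i + e 0 ^ 2 * R (i + 1) := fun i => by
    have := path_ratio_le (h := fun m => h (facePath s inv γ i (m + 1))) (fun m => hpos _)
      (fun m => face_superharmonic hs hsup hc γ i (m + 1)) e (q + 2)
    rw [he, (facePath_last hs γ i).1, (facePath_last hs γ i).2] at this
    exact this
  have hback : ∀ i, γ * s i * s (inv i) = γ := fun i => by
    rw [hs.map_inv, mul_inv_cancel_right]
  have hleft : ∀ i, y i + L i ≤ Λ - c := fun i => by
    have h3 := hsup (γ * s i)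
    rw [sum_eq_add_sum_range_add_two _ (inv i), hback] at h3
    have h4 := hc (γ * s i) (inv i + 1)
    rw [hy, hL]
    simp only
    rw [← add_div, div_le_iff₀ (hpos _)]
    linarith
  have hright : ∀ i, y i + R i ≤ Λ - c := fun i => by
    have h3 := hsup (γ * s i)
    rw [sum_eq_add_sum_range_add_three _ (inv i), hback] at h3
    have h4 := hc (γ * s i) (inv i + 2)
    rw [Finset.sum_range_succ] at h4
    have h0 : ((q + 5 : ℕ) : ZMod (q + 5)) = 0 := ZMod.natCast_self _
    have h5 : inv i + 2 + ((q + 2 : ℕ) : ZMod (q + 5)) = inv i - 1 := by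
      push_cast at h0 ⊢
      linear_combination h0
    rw [h5] at h4
    rw [hy, hR]
    simp only
    rw [← add_div, div_le_iff₀ (hpos _)]
    linarith
  -- An inner neighbour of the fan lies on two of its arcs. Removing three consecutive directions
  -- leaves `q + 2`, hence `c'`; an end neighbour lies on one arc only, hence `c` above.
  have hboth : ∀ i, y i + L i + R i ≤ Λ - c' := fun i => by
    have h3 := hsup (γ * s i)
    rw [sum_eq_add_sum_range_add_three _ (inv i), hback] at h3
    have h4 := hc' (γ * s i) (inv i + 2)
    rw [hy, hL, hR]
    simp only
    rw [← add_div, ← add_div, div_le_iff₀ (hpos _)]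
    linarith
  have hind : ∀ t : ℕ, ∑ m ∈ Finset.range (t + 1), e 0 ^ 2 * y (d + m) + e 0 ^ 2 * L (d + t) ≤
      e 0 ^ 2 * (Λ - c + t * (Λ - c')) - t * A := fun t => by
    induction t with
    | zero =>
      have := mul_le_mul_of_nonneg_left (hleft (d + (0 : ℕ))) (sq_nonneg (e 0))
      rw [mul_add] at this
      simpa using this
    | succ t ih =>
      rw [Finset.sum_range_succ]
      have h1 := mul_le_mul_of_nonneg_left (hboth (d + (t + 1 : ℕ))) (sq_nonneg (e 0))
      have h2 := harc (d + t)
      rw [add_assoc, ← Nat.cast_succ, Nat.succ_eq_add_one] at h2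
      have h3 : ((t + 1 : ℕ) : ℝ) = t + 1 := by push_cast; rfl
      rw [h3]
      linarith
  have htot : ∑ m ∈ Finset.range (n + 2), e 0 ^ 2 * y (d + m) ≤
      e 0 ^ 2 * (2 * (Λ - c) + n * (Λ - c')) - (n + 1) * A := by
    rw [Finset.sum_range_succ]
    have h1 := mul_le_mul_of_nonneg_left (hright (d + (n + 1 : ℕ))) (sq_nonneg (e 0))
    have h2 := harc (d + n)
    rw [add_assoc, ← Nat.cast_succ, Nat.succ_eq_add_one] at h2
    have h3 := hind n
    linarith
  -- A tangent-line bound for the inverse of `y i`, with equality when `h (γ * s i) = e 0 * h γ`;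
  -- thus `e 0` is a guess for the outward ratio.
  have hamgm : ∀ i, 2 * e 0 - e 0 ^ 2 * y i ≤ h (γ * s i) / h γ := fun i => by
    have h1 := hpos γ
    have h2 := hpos (γ * s i)
    have h3 : h (γ * s i) / h γ - (2 * e 0 - e 0 ^ 2 * y i) =
        (h (γ * s i) - e 0 * h γ) ^ 2 / (h γ * h (γ * s i)) := by
      simp only [hy]
      field_simp
      ring
    have h4 : 0 ≤ (h (γ * s i) - e 0 * h γ) ^ 2 / (h γ * h (γ * s i)) := by positivity
    linarith
  rw [Finset.sum_div]
  have hfin := Finset.sum_le_sum fun m (_ : m ∈ Finset.range (n + 2)) => hamgm (d + m)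
  rw [Finset.sum_sub_distrib, Finset.sum_const, Finset.card_range, nsmul_eq_mul] at hfin
  push_cast at hfin
  linarith

/-- The infima of the normalized sums of a positive superharmonic function over `q + 3` and over
`q + 2` consecutive neighbours satisfy a system of linear inequalities. -/
theorem exists_fan_infima (hs : IsCyclicOrder s inv) (hpos : ∀ γ, 0 < h γ)
    (hsup : ∀ γ, ∑ i, h (γ * s i) ≤ Λ * h γ) (e : ℕ → ℝ) (he : e (q + 3) = e 0) :
    ∃ c c' : ℝ, 0 ≤ c' ∧ c' ≤ c ∧ c ≤ Λ ∧
      2 * (q + 3) * e 0 - e 0 ^ 2 * (2 * (Λ - c) + (q + 1) * (Λ - c')) +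
        (q + 2) * (2 * ∑ m ∈ Finset.range (q + 3), e m * e (m + 1) -
          (Λ - c) * ∑ m ∈ Finset.range (q + 2), e (m + 1) ^ 2) ≤ c ∧
      2 * (q + 2) * e 0 - e 0 ^ 2 * (2 * (Λ - c) + q * (Λ - c')) +
        (q + 1) * (2 * ∑ m ∈ Finset.range (q + 3), e m * e (m + 1) -
          (Λ - c) * ∑ m ∈ Finset.range (q + 2), e (m + 1) ^ 2) ≤ c' := by
  set f : ℕ → Γ × ZMod (q + 5) → ℝ := fun n x =>
    (∑ m ∈ Finset.range n, h (x.1 * s (x.2 + m))) / h x.1 with hf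
  have hf0 : ∀ n x, 0 ≤ f n x := fun n x =>
    div_nonneg (Finset.sum_nonneg fun m _ => (hpos _).le) (hpos _).le
  have hbdd : ∀ n, BddBelow (Set.range (f n)) := fun n => ⟨0, by
    rintro _ ⟨x, rfl⟩
    exact hf0 n x⟩
  have hle : ∀ n γ d, (⨅ x, f n x) * h γ ≤ ∑ m ∈ Finset.range n, h (γ * s (d + m)) :=
    fun n γ d => (le_div_iff₀ (hpos γ)).1 (ciInf_le (hbdd n) (γ, d))
  have hmono : ∀ x, f (q + 2) x ≤ f (q + 3) x := fun x => by
    simp only [hf]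
    rw [Finset.sum_range_succ _ (q + 2)]
    exact div_le_div_of_nonneg_right (le_add_of_nonneg_right (hpos _).le) (hpos _).le
  refine ⟨⨅ x, f (q + 3) x, ⨅ x, f (q + 2) x, Real.iInf_nonneg (hf0 _),
    ciInf_mono (hbdd _) hmono, ?_, ?_, ?_⟩
  · refine (ciInf_le (hbdd _) (1, 0 + 1)).trans ?_
    simp only [hf]
    rw [div_le_iff₀ (hpos _)]
    refine le_trans ?_ (hsup 1)
    rw [sum_eq_add_sum_range_add_two _ 0]
    have h1 := hpos (1 * s (0 - 1))
    have h2 := hpos (1 * s 0)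
    linarith
  · refine le_ciInf fun x => ?_
    have := fan_sum_ge hs hpos hsup (hle _) (hle _) e he (q + 1) x.1 x.2
    refine le_trans (le_of_eq ?_) this
    push_cast
    ring
  · refine le_ciInf fun x => ?_
    exact fan_sum_ge hs hpos hsup (hle _) (hle _) e he q x.1 x.2

/-- The test sequence nearly solves `e m + e (m + 2) = μ * e (m + 1)` with `μ` about `3.045`, close
to `Λ - c` for `c = 6 * e 0`. This keeps the estimates along the arcs nearly sharp. The default `0`
is never reached. -/
theorem not_superharmonic_eight {s : ZMod 8 → Γ} {inv : ZMod 8 → ZMod 8} {h : Γ → ℝ}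
    (hs : IsCyclicOrder s inv) (hpos : ∀ γ, 0 < h γ)
    (hsup : ∀ γ, ∑ i, h (γ * s i) ≤ 8 * 0.662418 * h γ) : False := by
  obtain ⟨c, c', h1, h2, h3, h4, h5⟩ := exists_fan_infima (q := 3) hs hpos hsup
    (fun m => [0.3756, 0.143, 0.0598, 0.0393, 0.0598, 0.143, 0.3756].getD m 0) rfl
  simp [Finset.sum_range_succ] at h4 h5
  norm_num at h4 h5
  linarith

theorem not_superharmonic_twelve {s : ZMod 12 → Γ} {inv : ZMod 12 → ZMod 12} {h : Γ → ℝ}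
    (hs : IsCyclicOrder s inv) (hpos : ∀ γ, 0 < h γ)
    (hsup : ∀ γ, ∑ i, h (γ * s i) ≤ 12 * 0.552773 * h γ) : False := by
  -- Chosen as in degree eight, now with `μ` about `3.618` and `c` about `10 * e 0`.
  obtain ⟨c, c', h1, h2, h3, h4, h5⟩ := exists_fan_infima (q := 7) hs hpos hsup
    (fun m => [0.3015006, 0.090907, 0.027427, 0.008331, 0.002718, 0.001502, 0.002718, 0.008331,
      0.027427, 0.090907, 0.3015006].getD m 0) rfl
  simp [Finset.sum_range_succ] at h4 h5
  norm_num at h4 h5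
  linarith

end LowerBound

/-! ### Upper bound: combinatorics of the edge weights -/

section UpperBound

/-- The weight of an edge in the direction `i`, in terms of whether the edge crosses its wall
towards the base point, and of the number of walls crossed already around its two faces. -/
def edgeWeight (u : ℕ → ℝ) (H : Prop) [Decidable H] (n : ℕ) : ℝ := if H then u n else (u (n + 1))⁻¹

theorem sum_le_sum_add_card_mul {k : ℕ} [NeZero k] (f : ZMod k → ℝ) (w : ℝ) (T : Finset (ZMod k))
    (h : ∀ x ∉ T, f x ≤ w) : ∑ x, f x ≤ ∑ x ∈ T, f x + (k - T.card) * w := by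
  rw [← Finset.sum_add_sum_compl T f]
  refine add_le_add le_rfl ?_
  refine (Finset.sum_le_card_nsmul _ f w fun x hx => h x (Finset.mem_compl.1 hx)).trans ?_
  rw [Finset.card_compl, ZMod.card, nsmul_eq_mul, Nat.cast_sub]
  exact (Finset.card_le_univ T).trans_eq (ZMod.card k)

variable {k m : ℕ} [NeZero k] {u : ℕ → ℝ} {Λ : ℝ}

/-- The numerical inequalities on the weights of the edge types. -/
structure IsAdmissibleWeight (k m : ℕ) (u : ℕ → ℝ) (Λ : ℝ) : Prop where
  pos : ∀ n, 0 < u n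
  base : k * (u 1)⁻¹ ≤ Λ
  single : ∀ n, 1 ≤ n → n < m → u n + (u (n + 1))⁻¹ + (u 2)⁻¹ + (k - 3) * (u 1)⁻¹ ≤ Λ
  double : 2 * u m + 2 * (u 2)⁻¹ + (k - 4) * (u 1)⁻¹ ≤ Λ

-- `N i` counts separating walls at the vertex between the sides `i` and `i + 1`. The sides facing
-- the base point number none, one, or two adjacent ones, and these cases are the fields `base`,
-- `single` and `double`. By `hone`, the count is `1` at one end of a facing side.
open scoped Classical in
theorem sum_edgeWeight_le (hu : IsAdmissibleWeight k m u Λ) (hm : 2 ≤ m) (h1 : (1 : ZMod k) ≠ 0)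
    (h2 : (2 : ZMod k) ≠ 0) (h3 : (3 : ZMod k) ≠ 0) (H : ZMod k → Prop) (N : ZMod k → ℕ)
    (hN : ∀ i, N i ≤ m) (hN0 : ∀ i, N i = 0 ↔ ¬H i ∧ ¬H (i + 1))
    (hNm : ∀ i, N i = m ↔ H i ∧ H (i + 1))
    (hH : ∀ i j, H i → H j → j = i ∨ j = i + 1 ∨ j = i - 1)
    (hone : ∀ i, H i → N i ≤ 1 ∨ N (i - 1) ≤ 1) :
    ∑ i, edgeWeight u (H i) (max (N i) (N (i - 1))) ≤ Λ := by
  have hzero : ∀ j, ¬H (j - 1) → ¬H j → ¬H (j + 1) →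
      edgeWeight u (H j) (max (N j) (N (j - 1))) = (u 1)⁻¹ := fun j ha hb hc => by
    rw [edgeWeight, if_neg hb, (hN0 j).2 ⟨hb, hc⟩, (hN0 (j - 1)).2 ⟨ha, by rwa [sub_add_cancel]⟩]
    rfl
  by_cases hex : ∃ i, H i
  swap
  · push Not at hex
    rw [Finset.sum_congr rfl fun j _ => hzero j (hex _) (hex _) (hex _)]
    simpa using hu.base
  by_cases hex2 : ∃ i, H i ∧ H (i + 1)
  · obtain ⟨i, hi, hi1⟩ := hex2
    have hother : ∀ j, j ≠ i → j ≠ i + 1 → ¬H j := fun j ha hb hj => by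
      rcases hH i j hi hj with h | h | h
      · exact ha h
      · exact hb h
      · rcases hH (i + 1) j hi1 hj with h' | h' | h'
        · exact hb h'
        · exact h3 (by linear_combination h - h')
        · exact ha (by rw [h']; ring)
    have e1 : ¬H (i - 1) := hother _ (fun h => h1 (by linear_combination -h))
      (fun h => h2 (by linear_combination -h))
    have e2 : ¬H (i + 2) := hother _ (fun h => h2 (by linear_combination h))
      (fun h => h1 (by linear_combination h))
    have e3 : N i = m := (hNm i).2 ⟨hi, hi1⟩
    have e4 : N (i - 1) = 1 := by
      have ha : N (i - 1) ≤ 1 := by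
        rcases hone i hi with h | h
        · omega
        · exact h
      have hb : N (i - 1) ≠ 0 := fun h => ((hN0 _).1 h).2 (by rwa [sub_add_cancel])
      omega
    have e5 : N (i + 1) = 1 := by
      have ha : N (i + 1) ≤ 1 := by
        rcases hone (i + 1) hi1 with h | h
        · exact h
        · rw [add_sub_cancel_right] at h; omega
      have hb : N (i + 1) ≠ 0 := fun h => ((hN0 _).1 h).1 hi1
      omega
    have e7 : N (i - 2) = 0 := (hN0 _).2
      ⟨hother _ (fun h => h2 (by linear_combination -h)) (fun h => h3 (by linear_combination -h)),
        by rwa [show i - 2 + 1 = i - 1 by ring]⟩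
    have e6 : N (i + 2) = 0 := (hN0 _).2 ⟨e2, by
      rw [show i + 2 + 1 = i + 3 by ring]
      exact hother _ (fun h => h3 (by linear_combination h)) (fun h => h2 (by linear_combination h))⟩
    have s1 : edgeWeight u (H i) (max (N i) (N (i - 1))) = u m := by
      rw [edgeWeight, if_pos hi, e3, e4, max_eq_left (by omega)]
    have s2 : edgeWeight u (H (i + 1)) (max (N (i + 1)) (N (i + 1 - 1))) = u m := by
      rw [edgeWeight, if_pos hi1, add_sub_cancel_right, e3, e5, max_eq_right (by omega)]
    have s3 : edgeWeight u (H (i - 1)) (max (N (i - 1)) (N (i - 1 - 1))) = (u 2)⁻¹ := by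
      rw [edgeWeight, if_neg e1, e4, show i - 1 - 1 = i - 2 by ring, e7]; rfl
    have s4 : edgeWeight u (H (i + 2)) (max (N (i + 2)) (N (i + 2 - 1))) = (u 2)⁻¹ := by
      rw [edgeWeight, if_neg e2, e6, show i + 2 - 1 = i + 1 by ring, e5]; rfl
    have d1 : i ≠ i + 1 := fun h => h1 (by linear_combination -h)
    have d2 : i ≠ i - 1 := fun h => h1 (by linear_combination h)
    have d3 : i ≠ i + 2 := fun h => h2 (by linear_combination -h)
    have d4 : i + 1 ≠ i - 1 := fun h => h2 (by linear_combination h)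
    have d5 : i + 1 ≠ i + 2 := fun h => h1 (by linear_combination -h)
    have d6 : i - 1 ≠ i + 2 := fun h => h3 (by linear_combination -h)
    refine (sum_le_sum_add_card_mul _ (u 1)⁻¹ {i, i + 1, i - 1, i + 2} fun j hj => ?_).trans ?_
    · simp only [Finset.mem_insert, Finset.mem_singleton, not_or] at hj
      obtain ⟨ha, hb, hc, hd⟩ := hj
      exact (hzero j
        (hother _ (fun h => hb (by linear_combination h)) (fun h => hd (by linear_combination h)))
        (hother _ ha hb)
        (hother _ (fun h => hc (by linear_combination h)) (fun h => ha (by linear_combination h)))).le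
    · have hcard : ({i, i + 1, i - 1, i + 2} : Finset (ZMod k)).card = 4 := by
        simp [d1, d2, d3, d4, d5, d6]
      rw [hcard, Finset.sum_insert (by simp [d1, d2, d3]), Finset.sum_insert (by simp [d4, d5]),
        Finset.sum_insert (by simp [d6]), Finset.sum_singleton, s1, s2, s3, s4]
      refine le_trans (le_of_eq ?_) hu.double
      push_cast
      ring
  · push Not at hex2
    obtain ⟨i, hi⟩ := hex
    have hip : ¬H (i + 1) := hex2 i hi
    have him : ¬H (i - 1) := fun h => hex2 _ h (by rwa [sub_add_cancel])
    have hother : ∀ j, j ≠ i → ¬H j := fun j ha hj => by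
      rcases hH i j hi hj with h | h | h
      · exact ha h
      · exact hip (h ▸ hj)
      · exact him (h ▸ hj)
    have n1 : N i ≠ 0 := fun h => ((hN0 _).1 h).1 hi
    have n2 : N i ≠ m := fun h => hip ((hNm _).1 h).2
    have n3 : N (i - 1) ≠ 0 := fun h => ((hN0 _).1 h).2 (by rwa [sub_add_cancel])
    have n4 : N (i - 1) ≠ m := fun h => him ((hNm _).1 h).1
    have n5 : N (i + 1) = 0 := (hN0 _).2 ⟨hip, hother _ fun h => h2 (by linear_combination h)⟩
    have n6 : N (i - 2) = 0 := (hN0 _).2 ⟨hother _ fun h => h2 (by linear_combination -h),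
      by rwa [show i - 2 + 1 = i - 1 by ring]⟩
    have s1 : edgeWeight u (H i) (max (N i) (N (i - 1))) = u (max (N i) (N (i - 1))) := by
      rw [edgeWeight, if_pos hi]
    have s2 : edgeWeight u (H (i + 1)) (max (N (i + 1)) (N (i + 1 - 1))) = (u (N i + 1))⁻¹ := by
      rw [edgeWeight, if_neg hip, add_sub_cancel_right, n5, Nat.zero_max]
    have s3 : edgeWeight u (H (i - 1)) (max (N (i - 1)) (N (i - 1 - 1))) =
        (u (N (i - 1) + 1))⁻¹ := by
      rw [edgeWeight, if_neg him, show i - 1 - 1 = i - 2 by ring, n6, Nat.max_zero]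
    have d1 : i ≠ i + 1 := fun h => h1 (by linear_combination -h)
    have d2 : i ≠ i - 1 := fun h => h1 (by linear_combination h)
    have d4 : i + 1 ≠ i - 1 := fun h => h2 (by linear_combination h)
    refine (sum_le_sum_add_card_mul _ (u 1)⁻¹ {i, i + 1, i - 1} fun j hj => ?_).trans ?_
    · simp only [Finset.mem_insert, Finset.mem_singleton, not_or] at hj
      obtain ⟨ha, hb, hc⟩ := hj
      exact (hzero j (hother _ fun h => hb (by linear_combination h)) (hother _ ha)
        (hother _ fun h => hc (by linear_combination h))).le
    · have hcard : ({i, i + 1, i - 1} : Finset (ZMod k)).card = 3 := by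
        simp [d1, d2, d4]
      rw [hcard, Finset.sum_insert (by simp [d1, d2]), Finset.sum_insert (by simp [d4]),
        Finset.sum_singleton, s1, s2, s3]
      have l1 := hN i
      have l2 := hN (i - 1)
      rcases hone i hi with h | h
      · have e : N i = 1 := by omega
        have := hu.single (N (i - 1)) (by omega) (by omega)
        rw [e, max_eq_right (by omega)]
        push_cast
        linarith
      · have e : N (i - 1) = 1 := by omega
        have := hu.single (N i) (by omega) (by omega)
        rw [e, max_eq_left (by omega)]
        push_cast
        linarith

/-- The properties of the number of walls through a vertex of a regular polygon, of angle `π / m`,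
that separate a point from the polygon, as a function of the coordinates of the point with respect
to the two sides at the vertex. -/
structure IsDihedralCount (m : ℕ) (σ : ℝ) (ν : ℝ → ℝ → ℕ) : Prop where
  le : ∀ p q, ν p q ≤ m
  eq_zero : ∀ p q, ν p q = 0 ↔ ¬p < 0 ∧ ¬q < 0
  eq_max : ∀ p q, ν p q = m ↔ p < 0 ∧ q < 0
  symm : ∀ p q, ν p q = ν q p
  reflect : ∀ p q, 0 < p → ν (-p) (q + σ * p) = ν p q + 1

/-- The four linear forms are the positive roots of the dihedral group of order `8`, up to scale.
The reflection in `p` permutes those other than `p`, so only the sign of `p` changes. -/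
theorem isDihedralCount_four {σ : ℝ} (hσ0 : 0 < σ) (hσ : σ ^ 2 = 2) :
    IsDihedralCount 4 σ fun p q => (if p < 0 then 1 else 0) + (if σ * p + q < 0 then 1 else 0) +
      (if p + σ * q < 0 then 1 else 0) + (if q < 0 then 1 else 0) where
  le p q := by split_ifs <;> omega
  eq_zero p q := by
    constructor
    · intro h
      constructor <;> intro hp <;> simp [hp] at h
    · rintro ⟨hp, hq⟩
      have h1 : ¬σ * p + q < 0 := by nlinarith
      have h2 : ¬p + σ * q < 0 := by nlinarith
      simp [hp, hq, h1, h2]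
  eq_max p q := by
    constructor
    · intro h
      constructor <;> by_contra hp <;> simp only [hp, if_false] at h <;> split_ifs at h <;> omega
    · rintro ⟨hp, hq⟩
      have h1 : σ * p + q < 0 := by nlinarith
      have h2 : p + σ * q < 0 := by nlinarith
      simp [hp, hq, h1, h2]
  symm p q := by
    rw [add_comm (σ * p), add_comm p]
    ring
  reflect p q hp := by
    rw [if_pos (by linarith : -p < 0), if_neg (by linarith : ¬p < 0),
      show σ * -p + (q + σ * p) = q by ring, add_comm (σ * p) q,
      show -p + σ * (q + σ * p) = p + σ * q by linear_combination p * hσ]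
    ring

/-- Same argument with the six positive roots of the dihedral group of order `12`, up to scale. -/
theorem isDihedralCount_six {σ : ℝ} (hσ0 : 0 < σ) (hσ : σ ^ 2 = 3) :
    IsDihedralCount 6 σ fun p q => (if p < 0 then 1 else 0) + (if σ * p + q < 0 then 1 else 0) +
      (if 2 * p + σ * q < 0 then 1 else 0) + (if σ * p + 2 * q < 0 then 1 else 0) +
      (if p + σ * q < 0 then 1 else 0) + (if q < 0 then 1 else 0) where
  le p q := by split_ifs <;> omega
  eq_zero p q := by
    constructor
    · intro h
      constructor <;> intro hp <;> simp [hp] at h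
    · rintro ⟨hp, hq⟩
      have h1 : ¬σ * p + q < 0 := by nlinarith
      have h2 : ¬p + σ * q < 0 := by nlinarith
      have h3 : ¬σ * p + 2 * q < 0 := by nlinarith
      have h4 : ¬2 * p + σ * q < 0 := by nlinarith
      simp [hp, hq, h1, h2, h3, h4]
  eq_max p q := by
    constructor
    · intro h
      constructor <;> by_contra hp <;> simp only [hp, if_false] at h <;> split_ifs at h <;> omega
    · rintro ⟨hp, hq⟩
      have h1 : σ * p + q < 0 := by nlinarith
      have h2 : p + σ * q < 0 := by nlinarith
      have h3 : σ * p + 2 * q < 0 := by nlinarith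
      have h4 : 2 * p + σ * q < 0 := by nlinarith
      simp [hp, hq, h1, h2, h3, h4]
  symm p q := by
    rw [add_comm (σ * p), add_comm p, add_comm (2 * p), add_comm (σ * p)]
    ring
  reflect p q hp := by
    rw [if_pos (by linarith : -p < 0), if_neg (by linarith : ¬p < 0),
      show σ * -p + (q + σ * p) = q by ring, add_comm (σ * p) q,
      show -p + σ * (q + σ * p) = 2 * p + σ * q by linear_combination p * hσ,
      show 2 * -p + σ * (q + σ * p) = p + σ * q by linear_combination p * hσ,
      show σ * -p + 2 * (q + σ * p) = σ * p + 2 * q by ring]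
    ring

end UpperBound

/-! ### The regular polygon in the hyperboloid model -/

section HyperbolicPolygon

open ComplexConjugate

/-- The standard primitive character of `ℤ/k`, sending `1` to `exp (2πi/k)`. -/
abbrev zeta {k : ℕ} [NeZero k] (i : ZMod k) : ℂ := ZMod.stdAddChar i

/-- The linear form on Minkowski space `ℂ × ℝ` cutting out the `i`-th side of a regular polygon. -/
def wallForm {k : ℕ} [NeZero k] (C S : ℝ) (i : ZMod k) : ℂ × ℝ →ₗ[ℝ] ℝ where
  toFun x := S * x.2 - C * (zeta (-i) * x.1).re
  map_add' x y := by
    simp only [Prod.snd_add, Prod.fst_add, mul_add, Complex.add_re]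
    ring
  map_smul' a x := by
    simp only [Prod.smul_snd, Prod.smul_fst, smul_eq_mul, Complex.real_smul, RingHom.id_apply]
    rw [mul_left_comm (zeta (-i)), Complex.re_ofReal_mul]
    ring

/-- The vector dual to `wallForm`, up to sign. -/
def wallVec {k : ℕ} [NeZero k] (C S : ℝ) (i : ZMod k) : ℂ × ℝ := ((C : ℂ) * zeta i, S)

variable {k : ℕ} [NeZero k] {C S σ : ℝ}

theorem wallForm_apply (i : ZMod k) (x : ℂ × ℝ) :
    wallForm C S i x = S * x.2 - C * (zeta (-i) * x.1).re := rfl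

theorem wallForm_wallVec (i j : ZMod k) :
    wallForm C S i (wallVec C S j) = S ^ 2 - C ^ 2 * (zeta (j - i)).re := by
  rw [wallForm_apply, wallVec]
  simp only
  rw [mul_left_comm, Complex.re_ofReal_mul, ← AddChar.map_add_eq_mul, neg_add_eq_sub]
  ring

theorem zeta_neg (i : ZMod k) : zeta (-i) = conj (zeta i) := AddChar.map_neg_eq_conj _ _

theorem zeta_zero : zeta (0 : ZMod k) = 1 := AddChar.map_zero_eq_one _

theorem norm_zeta (i : ZMod k) : ‖zeta i‖ = 1 := AddChar.norm_apply _ _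

/-- The conditions on the parameters under which the forms `wallForm` define a regular `k`-gon in
the hyperbolic plane with angle `π / m` where `σ = 2 cos (π / m)`, whose non-adjacent sides have
disjoint lines. -/
structure IsPolygon (k : ℕ) [NeZero k] (C S σ : ℝ) : Prop where
  C_pos : 0 < C
  S_pos : 0 < S
  sub_eq_one : C ^ 2 - S ^ 2 = 1
  adjacent : 2 * (S ^ 2 - C ^ 2 * (zeta (1 : ZMod k)).re) = σ
  separated : ∀ d : ZMod k, d ≠ 0 → d ≠ 1 → d ≠ -1 → C ^ 2 * (1 + (zeta d).re) ≤ 2 * S ^ 2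

/-- The open forward light cone. -/
def forwardCone : Set (ℂ × ℝ) := {x | ‖x.1‖ < x.2}

theorem isOpen_forwardCone : IsOpen forwardCone :=
  isOpen_lt (continuous_fst.norm) continuous_snd

/-- For non-adjacent sides the sum of the two forms is nonnegative on the cone: `separated` says
exactly that `C * ‖zeta (-i) + zeta (-j)‖ ≤ 2 * S`. -/
theorem IsPolygon.eq_or_adjacent (hP : IsPolygon k C S σ) {x : ℂ × ℝ} (hx : x ∈ forwardCone)
    {i j : ZMod k} (hi : wallForm C S i x < 0) (hj : wallForm C S j x < 0) :
    j = i ∨ j = i + 1 ∨ j = i - 1 := by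
  by_contra hcon
  push Not at hcon
  obtain ⟨h0, h1, h2⟩ := hcon
  have hsep := hP.separated (j - i) (sub_ne_zero.2 h0)
    (fun h => h1 (by linear_combination h)) (fun h => h2 (by linear_combination h))
  rw [wallForm_apply] at hi hj
  have hxt : ‖x.1‖ < x.2 := hx
  have hsum : 2 * S * x.2 < C * ((zeta (-i) + zeta (-j)) * x.1).re := by
    rw [add_mul, Complex.add_re]
    linarith
  have hnorm : ‖zeta (-i) + zeta (-j)‖ ^ 2 = 2 + 2 * (zeta (j - i)).re := by
    rw [← Complex.normSq_eq_norm_sq, Complex.normSq_add, Complex.normSq_eq_norm_sq,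
      Complex.normSq_eq_norm_sq, norm_zeta, norm_zeta, ← zeta_neg, neg_neg,
      ← AddChar.map_add_eq_mul, neg_add_eq_sub]
    norm_num
  have hle : C * ‖zeta (-i) + zeta (-j)‖ ≤ 2 * S := by
    refine abs_le_of_sq_le_sq' ?_ (by linarith [hP.S_pos]) |>.2
    rw [mul_pow, hnorm]
    linarith
  have h3 : C * ((zeta (-i) + zeta (-j)) * x.1).re ≤ 2 * S * ‖x.1‖ := by
    calc C * ((zeta (-i) + zeta (-j)) * x.1).re ≤ C * (‖zeta (-i) + zeta (-j)‖ * ‖x.1‖) := by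
          rw [← norm_mul]
          exact mul_le_mul_of_nonneg_left (Complex.re_le_norm _) hP.C_pos.le
      _ = (C * ‖zeta (-i) + zeta (-j)‖) * ‖x.1‖ := by ring
      _ ≤ _ := mul_le_mul_of_nonneg_right hle (norm_nonneg _)
  have h4 : 2 * S * ‖x.1‖ < 2 * S * x.2 :=
    mul_lt_mul_of_pos_left hxt (by linarith [hP.S_pos])
  linarith

theorem IsPolygon.wallForm_wallVec_self (hP : IsPolygon k C S σ) (i : ZMod k) :
    wallForm C S i (wallVec C S i) = -1 := by
  rw [wallForm_wallVec, sub_self, zeta_zero, Complex.one_re]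
  linarith [hP.sub_eq_one]

theorem IsPolygon.wallForm_wallVec_add_one (hP : IsPolygon k C S σ) (i : ZMod k) :
    2 * wallForm C S i (wallVec C S (i + 1)) = σ := by
  rw [wallForm_wallVec, add_sub_cancel_left, hP.adjacent]

theorem IsPolygon.wallForm_add_one_wallVec (hP : IsPolygon k C S σ) (i : ZMod k) :
    2 * wallForm C S (i + 1) (wallVec C S i) = σ := by
  rw [wallForm_wallVec, sub_add_cancel_left, zeta_neg, Complex.conj_re, hP.adjacent]

/-- The reflection in the `i`-th side. -/
def wallReflection (hP : IsPolygon k C S σ) (i : ZMod k) : (ℂ × ℝ) ≃ₗ[ℝ] (ℂ × ℝ) :=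
  LinearEquiv.ofInvolutive
    (LinearMap.id + (2 : ℝ) • (wallForm C S i).smulRight (wallVec C S i)) fun x => by
      simp only [LinearMap.add_apply, LinearMap.id_apply, LinearMap.smul_apply,
        LinearMap.smulRight_apply, map_add, map_smul, hP.wallForm_wallVec_self]
      module

theorem wallReflection_apply (hP : IsPolygon k C S σ) (i : ZMod k) (x : ℂ × ℝ) :
    wallReflection hP i x = x + (2 * wallForm C S i x) • wallVec C S i := by
  rw [mul_smul]; rfl

/-- The symmetry of the polygon exchanging the sides `j` and `e - j`. -/
def polygonFlip (e : ZMod k) : (ℂ × ℝ) ≃ₗ[ℝ] (ℂ × ℝ) :=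
  LinearEquiv.ofInvolutive
    { toFun := fun x => (zeta e * conj x.1, x.2)
      map_add' := fun x y => by simp [mul_add]
      map_smul' := fun a x => by simp [mul_left_comm] } fun x => by
    ext1
    · change zeta e * conj (zeta e * conj x.1) = x.1
      rw [map_mul, Complex.conj_conj, ← zeta_neg, ← mul_assoc, ← AddChar.map_add_eq_mul,
        add_neg_cancel, AddChar.map_zero_eq_one, one_mul]
    · rfl

theorem polygonFlip_apply (e : ZMod k) (x : ℂ × ℝ) :
    polygonFlip e x = (zeta e * conj x.1, x.2) := rfl

theorem wallForm_polygonFlip (e i : ZMod k) (x : ℂ × ℝ) :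
    wallForm C S i (polygonFlip e x) = wallForm C S (e - i) x := by
  rw [wallForm_apply, wallForm_apply, polygonFlip_apply]
  simp only
  rw [← mul_assoc, ← AddChar.map_add_eq_mul, ← Complex.conj_re, map_mul, Complex.conj_conj,
    ← zeta_neg]
  congr 5
  ring

theorem polygonFlip_wallVec (e i : ZMod k) :
    polygonFlip e (wallVec C S i) = wallVec C S (e - i) := by
  rw [polygonFlip_apply, wallVec, wallVec, map_mul, Complex.conj_ofReal, ← zeta_neg,
    mul_left_comm, ← AddChar.map_add_eq_mul, ← sub_eq_add_neg]

theorem polygonFlip_mul_self (e : ZMod k) : polygonFlip e * polygonFlip e = 1 :=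
  LinearEquiv.ext fun x => (polygonFlip e).symm_apply_apply x

theorem polygonFlip_mul_wallReflection (hP : IsPolygon k C S σ) (e i : ZMod k) :
    polygonFlip e * wallReflection hP i = wallReflection hP (e - i) * polygonFlip e := by
  refine LinearEquiv.ext fun x => ?_
  rw [LinearEquiv.mul_apply, LinearEquiv.mul_apply, wallReflection_apply, wallReflection_apply,
    map_add, map_smul, polygonFlip_wallVec, wallForm_polygonFlip, sub_sub_cancel]

theorem wallReflection_mul_self (hP : IsPolygon k C S σ) (i : ZMod k) :
    wallReflection hP i * wallReflection hP i = 1 :=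
  LinearEquiv.ext fun x => (wallReflection hP i).symm_apply_apply x

theorem polygonFlip_mem_forwardCone (e : ZMod k) {x : ℂ × ℝ} (hx : x ∈ forwardCone) :
    polygonFlip e x ∈ forwardCone := by
  change ‖zeta e * conj x.1‖ < x.2
  rw [norm_mul, norm_zeta, one_mul, Complex.norm_conj]
  exact hx

/-- A reflection preserves the Minkowski form (`h9`), and the time coordinate stays nonnegative
(`hpos`). -/
theorem wallReflection_mem_forwardCone (hP : IsPolygon k C S σ) (i : ZMod k) {x : ℂ × ℝ}
    (hx : x ∈ forwardCone) : wallReflection hP i x ∈ forwardCone := by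
  have hxt : ‖x.1‖ < x.2 := hx
  set w : ℂ := zeta (-i) * x.1 with hw
  have hwn : ‖w‖ = ‖x.1‖ := by rw [hw, norm_mul, norm_zeta, one_mul]
  have hp : wallForm C S i x = S * x.2 - C * w.re := wallForm_apply i x
  have hre : w.re ≤ ‖x.1‖ := hwn ▸ Complex.re_le_norm w
  have h1 : (wallReflection hP i x).2 = x.2 + 2 * (S * x.2 - C * w.re) * S := by
    rw [wallReflection_apply, hp]; rfl
  have h2 : ‖(wallReflection hP i x).1‖ ^ 2 =
      ‖x.1‖ ^ 2 + 4 * (S * x.2 - C * w.re) * C * w.re + 4 * (S * x.2 - C * w.re) ^ 2 * C ^ 2 := by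
    have h3 : zeta (-i) * (wallReflection hP i x).1 =
        w + ((2 * (S * x.2 - C * w.re) * C : ℝ) : ℂ) := by
      rw [wallReflection_apply, hp]
      change zeta (-i) * (x.1 + (2 * (S * x.2 - C * w.re)) • ((C : ℂ) * zeta i)) = _
      have h4 : zeta (-i) * zeta i = 1 := by
        rw [← AddChar.map_add_eq_mul, neg_add_cancel, AddChar.map_zero_eq_one]
      rw [Complex.real_smul]
      push_cast
      linear_combination (2 * (S * x.2 - C * w.re) * C : ℂ) * h4
    have h5 : ‖(wallReflection hP i x).1‖ = ‖zeta (-i) * (wallReflection hP i x).1‖ := by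
      rw [norm_mul, norm_zeta, one_mul]
    rw [h5, h3, ← hwn, ← Complex.normSq_eq_norm_sq, ← Complex.normSq_eq_norm_sq,
      Complex.normSq_apply, Complex.normSq_apply]
    simp only [Complex.add_re, Complex.add_im, Complex.ofReal_re, Complex.ofReal_im]
    ring
  have hC := hP.C_pos
  have hS := hP.S_pos
  have hCS := hP.sub_eq_one
  have ht : 0 < x.2 := (norm_nonneg _).trans_lt hxt
  have hpos : 0 ≤ (wallReflection hP i x).2 := by
    rw [h1]
    have h6 : C * S * w.re ≤ C * S * x.2 := by
      refine mul_le_mul_of_nonneg_left (hre.trans hxt.le) (by positivity)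
    nlinarith [mul_nonneg ht.le (sq_nonneg (C - S))]
  refine abs_lt_of_sq_lt_sq ?_ hpos |> fun h => (le_abs_self _).trans_lt h
  rw [h2, h1]
  have h7 : ‖x.1‖ ^ 2 < x.2 ^ 2 := by
    exact pow_lt_pow_left₀ hxt (norm_nonneg _) two_ne_zero
  have h8 : C ^ 2 = 1 + S ^ 2 := by linarith
  have h9 : (x.2 + 2 * (S * x.2 - C * w.re) * S) ^ 2 - (4 * (S * x.2 - C * w.re) * C * w.re +
      4 * (S * x.2 - C * w.re) ^ 2 * C ^ 2) = x.2 ^ 2 := by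
    linear_combination (-4 * (S * x.2 - C * w.re) ^ 2) * hCS
  linarith

end HyperbolicPolygon

/-! ### Rotations about vertices and side pairings -/

section PolygonAction

variable {k m : ℕ} [NeZero k] {C S σ : ℝ}

theorem wallReflection_mul_apply (hP : IsPolygon k C S σ) (i : ZMod k) (x : ℂ × ℝ) :
    (wallReflection hP (i + 1) * wallReflection hP i) x =
      x + (2 * (wallForm C S (i + 1) x + σ * wallForm C S i x)) • wallVec C S (i + 1) +
        (2 * wallForm C S i x) • wallVec C S i := by
  rw [LinearEquiv.mul_apply, wallReflection_apply, wallReflection_apply, map_add, map_smul,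
    smul_eq_mul, ← hP.wallForm_add_one_wallVec i]
  module

theorem wallForm_wallReflection_mul (hP : IsPolygon k C S σ) (i : ZMod k) (x : ℂ × ℝ) :
    wallForm C S (i + 1) ((wallReflection hP (i + 1) * wallReflection hP i) x) =
        -wallForm C S (i + 1) x - σ * wallForm C S i x ∧
      wallForm C S i ((wallReflection hP (i + 1) * wallReflection hP i) x) =
        σ * wallForm C S (i + 1) x + (σ ^ 2 - 1) * wallForm C S i x := by
  rw [wallReflection_mul_apply]
  simp only [map_add, map_smul, smul_eq_mul, hP.wallForm_wallVec_self]
  have h1 := hP.wallForm_add_one_wallVec i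
  have h2 := hP.wallForm_wallVec_add_one i
  constructor
  · linear_combination (wallForm C S i x) * h1
  · linear_combination (wallForm C S (i + 1) x + σ * wallForm C S i x) * h2

/-- The displacement of `T` is linear in `P` and `Q`, so two orbits with opposite `(P, Q)` have
constant sum. Apply this to `x` and its half turn `T^[n] x`. -/
theorem iterate_two_mul_eq_self {V : Type*} [AddCommGroup V] [Module ℝ V] {T : V → V}
    {P Q : V → ℝ} {a b : V} {n : ℕ}
    (hT : ∀ y, T y = y + (2 * (P y + σ * Q y)) • a + (2 * Q y) • b)
    (hP : ∀ y, P (T y) = -P y - σ * Q y) (hQ : ∀ y, Q (T y) = σ * P y + (σ ^ 2 - 1) * Q y)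
    (hn : ∀ y, P (T^[n] y) = -P y ∧ Q (T^[n] y) = -Q y) (x : V) : T^[n] (T^[n] x) = x := by
  have key : ∀ j y y', P y' = -P y → Q y' = -Q y → T^[j] y' + T^[j] y = y' + y := by
    intro j
    induction j with
    | zero => intros; rfl
    | succ j ih =>
      intro y y' h1 h2
      rw [Function.iterate_succ_apply, Function.iterate_succ_apply,
        ih (T y) (T y') (by rw [hP, hP, h1, h2]; ring) (by rw [hQ, hQ, h1, h2]; ring), hT y, hT y',
        h1, h2]
      module
  have := key n x (T^[n] x) (hn x).1 (hn x).2
  rw [add_comm _ x] at this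
  exact add_right_cancel this

theorem wallReflection_mul_pow_four (hP : IsPolygon k C S σ) (hσ : σ ^ 2 = 2) (i : ZMod k) :
    (wallReflection hP (i + 1) * wallReflection hP i) ^ 4 = 1 := by
  have h1 := fun x => (wallForm_wallReflection_mul hP i x).1
  have h2 := fun x => (wallForm_wallReflection_mul hP i x).2
  have h3 := wallReflection_mul_apply hP i
  generalize wallReflection hP (i + 1) * wallReflection hP i = T at h1 h2 h3 ⊢
  refine LinearEquiv.ext fun x => iterate_two_mul_eq_self (T := T) (n := 2) h3 h1 h2 (fun y => ?_) x
  simp only [Function.iterate_succ_apply, Function.iterate_zero, id, h1, h2]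
  constructor
  · linear_combination -(wallForm C S (i + 1) y + σ * wallForm C S i y) * hσ
  · linear_combination (σ * wallForm C S (i + 1) y + (σ ^ 2 - 1) * wallForm C S i y) * hσ

theorem wallReflection_mul_pow_six (hP : IsPolygon k C S σ) (hσ : σ ^ 2 = 3) (i : ZMod k) :
    (wallReflection hP (i + 1) * wallReflection hP i) ^ 6 = 1 := by
  have h1 := fun x => (wallForm_wallReflection_mul hP i x).1
  have h2 := fun x => (wallForm_wallReflection_mul hP i x).2
  have h3 := wallReflection_mul_apply hP i
  generalize wallReflection hP (i + 1) * wallReflection hP i = T at h1 h2 h3 ⊢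
  refine LinearEquiv.ext fun x => iterate_two_mul_eq_self (T := T) (n := 3) h3 h1 h2 (fun y => ?_) x
  simp only [Function.iterate_succ_apply, Function.iterate_zero, id, h1, h2, hσ]
  constructor
  · linear_combination (σ * wallForm C S i y) * hσ
  · linear_combination -(σ * wallForm C S (i + 1) y + 3 * wallForm C S i y) * hσ

/-- The orientation-preserving isometry carrying the polygon to its neighbour across the side `i`,
and the side `e - i` to the side `i`. -/
def sidePairing (hP : IsPolygon k C S σ) (i e : ZMod k) : (ℂ × ℝ) ≃ₗ[ℝ] (ℂ × ℝ) :=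
  wallReflection hP i * polygonFlip e

theorem sidePairing_mul_sidePairing (hP : IsPolygon k C S σ) (i e : ZMod k) :
    sidePairing hP i e * sidePairing hP (e - i) e = 1 := by
  rw [sidePairing, sidePairing, mul_assoc, ← mul_assoc (polygonFlip e),
    polygonFlip_mul_wallReflection, sub_sub_cancel, mul_assoc (wallReflection hP i) (polygonFlip e),
    polygonFlip_mul_self, mul_one, wallReflection_mul_self]

/-- The rotation of the polygon carrying the side `i` to the side `i + c`. -/
def polygonRotation (c : ZMod k) : (ℂ × ℝ) ≃ₗ[ℝ] (ℂ × ℝ) := polygonFlip c * polygonFlip (0 : ZMod k)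

theorem polygonRotation_apply (c : ZMod k) (x : ℂ × ℝ) :
    polygonRotation c x = (zeta c * x.1, x.2) := by
  rw [polygonRotation, LinearEquiv.mul_apply, polygonFlip_apply, polygonFlip_apply]
  simp only
  rw [zeta_zero, one_mul, Complex.conj_conj]

theorem polygonFlip_mul_polygonFlip (e f : ZMod k) :
    polygonFlip e * polygonFlip f = polygonRotation (e - f) := by
  refine LinearEquiv.ext fun x => ?_
  rw [polygonRotation_apply, LinearEquiv.mul_apply, polygonFlip_apply, polygonFlip_apply]
  simp only
  rw [map_mul, Complex.conj_conj, ← zeta_neg, ← mul_assoc, ← AddChar.map_add_eq_mul,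
    sub_eq_add_neg]

theorem polygonRotation_zero : polygonRotation (0 : ZMod k) = 1 := polygonFlip_mul_self (0 : ZMod k)

theorem zeta_add (c d : ZMod k) : zeta (c + d) = zeta c * zeta d := AddChar.map_add_eq_mul _ _ _

theorem polygonRotation_mul_polygonRotation (c d : ZMod k) :
    polygonRotation c * polygonRotation d = polygonRotation (c + d) := by
  refine LinearEquiv.ext fun x => ?_
  rw [LinearEquiv.mul_apply, polygonRotation_apply, polygonRotation_apply, polygonRotation_apply,
    zeta_add, mul_assoc]

theorem polygonRotation_mul_wallReflection (hP : IsPolygon k C S σ) (c i : ZMod k) :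
    polygonRotation c * wallReflection hP i = wallReflection hP (i + c) * polygonRotation c := by
  rw [polygonRotation, mul_assoc, polygonFlip_mul_wallReflection, ← mul_assoc,
    polygonFlip_mul_wallReflection, mul_assoc]
  congr 2
  ring

/-- Push all flips to the right past the reflections. The flips compose to the rotation by `-4`, and
the reflections become those in two adjacent sides. -/
theorem sidePairing_commutator (hP : IsPolygon k C S σ) (i : ZMod k) :
    sidePairing hP (i + 1) (2 * i + 4) * sidePairing hP (i + 4) (2 * i + 6) *
      sidePairing hP (i + 3) (2 * i + 4) * sidePairing hP (i + 2) (2 * i + 6) =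
    (wallReflection hP (i + 1) * wallReflection hP i) ^ 2 * polygonRotation (-4 : ZMod k) := by
  have hr : ∀ (e j : ZMod k) X, polygonFlip e * (wallReflection hP j * X) =
      wallReflection hP (e - j) * (polygonFlip e * X) := fun e j X => by
    rw [← mul_assoc, polygonFlip_mul_wallReflection, mul_assoc]
  have hd : polygonFlip (2 * i + 4) * (polygonFlip (2 * i + 6) * (polygonFlip (2 * i + 4) *
      polygonFlip (2 * i + 6))) = polygonRotation (-4 : ZMod k) := by
    rw [← mul_assoc, polygonFlip_mul_polygonFlip, polygonRotation_mul_polygonRotation]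
    congr 1
    ring
  simp only [sidePairing, mul_assoc, hr, hd, pow_two]
  ring_nf

end PolygonAction

/-! ### Edge weights transported to the group -/

section PolygonAction

variable {k m : ℕ} [NeZero k] {C S σ : ℝ}

/-- A countable group of linear automorphisms has a point in the forward cone whose orbit avoids
all the walls. -/
theorem exists_generic_mem_forwardCone (hP : IsPolygon k C S σ) {Γ : Type*} [Group Γ] [Countable Γ]
    (ρ : Γ →* ((ℂ × ℝ) ≃ₗ[ℝ] (ℂ × ℝ))) :
    ∃ x ∈ forwardCone, ∀ γ (i : ZMod k), wallForm C S i (ρ γ x) ≠ 0 := by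
  set μ := MeasureTheory.Measure.addHaar (G := ℂ × ℝ)
  set B : Γ × ZMod k → Submodule ℝ (ℂ × ℝ) := fun y =>
    LinearMap.ker ((wallForm C S y.2).comp (ρ y.1).toLinearMap) with hB
  -- The bad points form a countable union of proper subspaces, a null set, whereas the cone is open
  -- and nonempty.
  have hnull : μ (⋃ y, (B y : Set (ℂ × ℝ))) = 0 := by
    rw [MeasureTheory.measure_iUnion_null_iff]
    intro y
    refine MeasureTheory.Measure.addHaar_submodule _ _ fun h => ?_
    have h1 : (ρ y.1).symm (wallVec C S y.2) ∈ B y := h ▸ Submodule.mem_top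
    rw [hB] at h1
    simp only [LinearMap.mem_ker, LinearMap.comp_apply, LinearEquiv.coe_coe,
      LinearEquiv.apply_symm_apply, hP.wallForm_wallVec_self] at h1
    norm_num at h1
  have hpos : 0 < μ forwardCone :=
    isOpen_forwardCone.measure_pos _ ⟨(0, 1), by simp [forwardCone]⟩
  obtain ⟨x, hx, hx'⟩ : ∃ x ∈ forwardCone, x ∉ ⋃ y, (B y : Set (ℂ × ℝ)) := by
    by_contra hcon
    push Not at hcon
    exact hpos.ne' (MeasureTheory.measure_mono_null hcon hnull)
  refine ⟨x, hx, fun γ i h => hx' (Set.mem_iUnion.2 ⟨(γ, i), h⟩)⟩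

/-- The number of walls through the `i`-th vertex of the polygon separating it from `x`. -/
def vertexCount (k : ℕ) [NeZero k] (C S : ℝ) (ν : ℝ → ℝ → ℕ) (x : ℂ × ℝ) (i : ZMod k) : ℕ :=
  ν (wallForm C S i x) (wallForm C S (i + 1) x)

open scoped Classical in
/-- The weight, seen from `x`, of the edge leaving the polygon through its side `i`. -/
def sideWeight (k : ℕ) [NeZero k] (C S : ℝ) (ν : ℝ → ℝ → ℕ) (u : ℕ → ℝ) (x : ℂ × ℝ) (i : ZMod k) :
    ℝ :=
  edgeWeight u (wallForm C S i x < 0)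
    (max (vertexCount k C S ν x i) (vertexCount k C S ν x (i - 1)))

variable {ν : ℝ → ℝ → ℕ} {u : ℕ → ℝ} {Λ : ℝ}

theorem vertexCount_polygonFlip (hν : IsDihedralCount m σ ν) (e i : ZMod k) (x : ℂ × ℝ) :
    vertexCount k C S ν (polygonFlip e x) i = vertexCount k C S ν x (e - i - 1) := by
  rw [vertexCount, vertexCount, wallForm_polygonFlip, wallForm_polygonFlip, hν.symm]
  congr 3 <;> ring

theorem sideWeight_polygonFlip (hν : IsDihedralCount m σ ν) (e i : ZMod k) (x : ℂ × ℝ) :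
    sideWeight k C S ν u (polygonFlip e x) i = sideWeight k C S ν u x (e - i) := by
  rw [sideWeight, sideWeight, vertexCount_polygonFlip hν, vertexCount_polygonFlip hν, max_comm]
  simp only [wallForm_polygonFlip]
  rw [show e - (i - 1) - 1 = e - i by ring]

theorem wallForm_wallReflection_self (hP : IsPolygon k C S σ) (i : ZMod k) (x : ℂ × ℝ) :
    wallForm C S i (wallReflection hP i x) = -wallForm C S i x := by
  rw [wallReflection_apply, map_add, map_smul, hP.wallForm_wallVec_self, smul_eq_mul]
  ring

theorem wallForm_wallReflection_add_one (hP : IsPolygon k C S σ) (i : ZMod k) (x : ℂ × ℝ) :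
    wallForm C S (i + 1) (wallReflection hP i x) =
      wallForm C S (i + 1) x + σ * wallForm C S i x := by
  rw [wallReflection_apply, map_add, map_smul, smul_eq_mul, ← hP.wallForm_add_one_wallVec i]
  ring

theorem wallForm_wallReflection_sub_one (hP : IsPolygon k C S σ) (i : ZMod k) (x : ℂ × ℝ) :
    wallForm C S (i - 1) (wallReflection hP i x) =
      wallForm C S (i - 1) x + σ * wallForm C S i x := by
  have := hP.wallForm_wallVec_add_one (i - 1)
  rw [sub_add_cancel] at this
  rw [wallReflection_apply, map_add, map_smul, smul_eq_mul, ← this]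
  ring

theorem vertexCount_wallReflection (hP : IsPolygon k C S σ) (hν : IsDihedralCount m σ ν)
    (i : ZMod k) {x : ℂ × ℝ} (hx : 0 < wallForm C S i x) :
    vertexCount k C S ν (wallReflection hP i x) i = vertexCount k C S ν x i + 1 ∧
      vertexCount k C S ν (wallReflection hP i x) (i - 1) = vertexCount k C S ν x (i - 1) + 1 := by
  rw [vertexCount, vertexCount, vertexCount, vertexCount, sub_add_cancel,
    wallForm_wallReflection_self, wallForm_wallReflection_add_one, wallForm_wallReflection_sub_one]
  refine ⟨hν.reflect _ _ hx, ?_⟩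
  rw [hν.symm, hν.symm _ (wallForm C S i x)]
  exact hν.reflect _ _ hx

theorem vertexCount_wallReflection_neg (hP : IsPolygon k C S σ) (hν : IsDihedralCount m σ ν)
    (i : ZMod k) {x : ℂ × ℝ} (hx : wallForm C S i x < 0) :
    vertexCount k C S ν (wallReflection hP i x) i + 1 = vertexCount k C S ν x i ∧
      vertexCount k C S ν (wallReflection hP i x) (i - 1) + 1 = vertexCount k C S ν x (i - 1) := by
  have h := vertexCount_wallReflection hP hν i (x := wallReflection hP i x) (by
    rw [wallForm_wallReflection_self]; linarith)
  rw [show wallReflection hP i (wallReflection hP i x) = x from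
    (wallReflection hP i).symm_apply_apply x] at h
  exact ⟨h.1.symm, h.2.symm⟩

/-- Crossing the wall changes both vertex counts by exactly one, hence also their maximum. This is
why `edgeWeight` has `u n` one way and the inverse of `u (n + 1)` the other. -/
theorem sideWeight_mul_wallReflection (hP : IsPolygon k C S σ) (hν : IsDihedralCount m σ ν)
    (hu : ∀ n, 0 < u n) (i : ZMod k) {x : ℂ × ℝ} (hx : wallForm C S i x ≠ 0) :
    sideWeight k C S ν u x i * sideWeight k C S ν u (wallReflection hP i x) i = 1 := by
  have hs := wallForm_wallReflection_self hP i x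
  rw [sideWeight, sideWeight, edgeWeight, edgeWeight]
  rcases lt_or_gt_of_ne hx with h | h
  · obtain ⟨h1, h2⟩ := vertexCount_wallReflection_neg hP hν i h
    rw [if_pos h, if_neg (by rw [hs]; linarith), ← h1, ← h2, ← max_add_add_right]
    exact mul_inv_cancel₀ (hu _).ne'
  · obtain ⟨h1, h2⟩ := vertexCount_wallReflection hP hν i h
    rw [if_neg (by linarith), if_pos (by rw [hs]; linarith), h1, h2, ← max_add_add_right]
    exact inv_mul_cancel₀ (hu _).ne'

theorem sum_sideWeight_le (hP : IsPolygon k C S σ) (hν : IsDihedralCount m σ ν)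
    (hu : IsAdmissibleWeight k m u Λ) (hm : 2 ≤ m) (h1 : (1 : ZMod k) ≠ 0) (h2 : (2 : ZMod k) ≠ 0)
    (h3 : (3 : ZMod k) ≠ 0) {x : ℂ × ℝ} (hx : x ∈ forwardCone) :
    ∑ i, sideWeight k C S ν u x i ≤ Λ := by
  refine sum_edgeWeight_le hu hm h1 h2 h3 (fun i => wallForm C S i x < 0)
    (fun i => vertexCount k C S ν x i) (fun i => hν.le _ _) (fun i => hν.eq_zero _ _)
    (fun i => hν.eq_max _ _) (fun i j => hP.eq_or_adjacent hx) fun i hi => ?_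
  -- If both counts were at least `2`, then after reflection in the side `i` both would still be
  -- nonzero. The point would then lie beyond both sides `i + 1` and `i - 1`, which are not
  -- adjacent.
  by_contra hcon
  push Not at hcon
  obtain ⟨e1, e2⟩ := vertexCount_wallReflection_neg hP hν i hi
  set y := wallReflection hP i x with hy
  have hyc : y ∈ forwardCone := wallReflection_mem_forwardCone hP i hx
  have hyi : ¬wallForm C S i y < 0 := by
    rw [wallForm_wallReflection_self]; linarith
  have f1 : vertexCount k C S ν y i ≠ 0 := by omega
  have f2 : vertexCount k C S ν y (i - 1) ≠ 0 := by omega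
  rw [vertexCount, Ne, hν.eq_zero] at f1 f2
  rw [sub_add_cancel] at f2
  have g1 : wallForm C S (i + 1) y < 0 := by tauto
  have g2 : wallForm C S (i - 1) y < 0 := by tauto
  rcases hP.eq_or_adjacent hyc g1 g2 with h | h | h
  · exact h2 (by linear_combination -h)
  · exact h3 (by linear_combination -h)
  · exact h1 (by linear_combination -h)

theorem norm_markovOperator_le_of_polygon (hP : IsPolygon k C S σ) (hν : IsDihedralCount m σ ν)
    (hu : IsAdmissibleWeight k m u Λ) (hm : 2 ≤ m) (h1 : (1 : ZMod k) ≠ 0) (h2 : (2 : ZMod k) ≠ 0)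
    (h3 : (3 : ZMod k) ≠ 0) {Γ : Type*} [Group Γ] [Countable Γ] {A : Finset Γ} {s : ZMod k → Γ}
    (hA : ∀ F : Γ → ℂ, ∑ x ∈ A, F x = ∑ i, F (s i)) (hc : A.card = k) (inv : ZMod k → ZMod k)
    (hinv : Function.Involutive inv) (hsinv : ∀ i, s (inv i) = (s i)⁻¹)
    (hgen : Subgroup.closure (Set.range s) = ⊤) (ρ : Γ →* ((ℂ × ℝ) ≃ₗ[ℝ] (ℂ × ℝ)))
    (hρ : ∀ i, ρ (s i) = sidePairing hP i (i + inv i)) : ‖markovOperator A‖ ≤ Λ / k := by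
  obtain ⟨x₀, hx₀, hgenr⟩ := exists_generic_mem_forwardCone hP ρ
  -- `ρ γ⁻¹ x₀` is the base point seen from the tile of `γ`. Moving to a neighbour reflects it in
  -- the common side and then relabels the sides by a flip.
  have hstep : ∀ γ i, ρ (γ * s i)⁻¹ x₀ =
      polygonFlip (i + inv i) (wallReflection hP i (ρ γ⁻¹ x₀)) := fun γ i => by
    have e : ρ (s i)⁻¹ = polygonFlip (i + inv i) * wallReflection hP i := by
      rw [map_inv, hρ, inv_eq_iff_mul_eq_one, sidePairing, mul_assoc,
        ← mul_assoc (polygonFlip (i + inv i)), polygonFlip_mul_self, one_mul,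
        wallReflection_mul_self]
    rw [mul_inv_rev, map_mul, e]
    rfl
  have hcone : ∀ γ, ρ γ⁻¹ x₀ ∈ forwardCone := fun γ => by
    have hmem : γ ∈ Subgroup.closure (Set.range s) := hgen ▸ Subgroup.mem_top γ
    have hs : ∀ γ i, ρ γ⁻¹ x₀ ∈ forwardCone → ρ (γ * s i)⁻¹ x₀ ∈ forwardCone := fun γ i h => by
      rw [hstep]
      exact polygonFlip_mem_forwardCone _ (wallReflection_mem_forwardCone hP i h)
    refine Subgroup.closure_induction_right (p := fun γ _ => ρ γ⁻¹ x₀ ∈ forwardCone) ?_ ?_ ?_ hmem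
    · rw [inv_one, map_one]
      exact hx₀
    · rintro γ _ _ ⟨i, rfl⟩ h
      exact hs γ i h
    · rintro γ _ _ ⟨i, rfl⟩ h
      rw [← hsinv]
      exact hs γ _ h
  have hΛ : 0 ≤ Λ := le_trans (mul_nonneg (Nat.cast_nonneg _) (inv_nonneg.2 (hu.pos 1).le)) hu.base
  have key := norm_markovOperator_le_of_edge_weight hA (by rw [hc, ZMod.card])
    (hinv.toPerm inv) (fun γ i => sideWeight k C S ν u (ρ γ⁻¹ x₀) i)
    (fun γ i => ?_) (fun γ i => ?_) hΛ
    (fun γ => sum_sideWeight_le hP hν hu hm h1 h2 h3 (hcone γ))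
  · rwa [ZMod.card] at key
  · rw [sideWeight, edgeWeight]
    split_ifs
    · exact hu.pos _
    · exact inv_pos.2 (hu.pos _)
  · rw [hstep, Function.Involutive.coe_toPerm, sideWeight_polygonFlip hν, add_sub_cancel_right]
    exact sideWeight_mul_wallReflection hP hν hu.pos i (hgenr _ _)

end PolygonAction

/-! ### Numerical verification for degrees eight and twelve -/

section Numerics

theorem zeta_natCast_re {k : ℕ} [NeZero k] (n : ℕ) :
    (zeta (n : ZMod k)).re = Real.cos (2 * Real.pi * n / k) := by
  have h := ZMod.stdAddChar_coe (N := k) (n : ℤ)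
  rw [Int.cast_natCast] at h
  rw [zeta, h, ← Complex.exp_ofReal_mul_I_re]
  congr 2
  push_cast
  ring

theorem zeta_re_le {k : ℕ} [NeZero k] {c : ℝ} (hc : Real.cos (4 * Real.pi / k) ≤ c)
    {d : ZMod k} (h : ∃ n : ℕ, 2 ≤ n ∧ 2 * n ≤ k ∧ (d = n ∨ d = -n)) : (zeta d).re ≤ c := by
  obtain ⟨n, h2, hk, hd⟩ := h
  have hk0 : (0 : ℝ) < k := Nat.cast_pos.2 (Nat.pos_of_neZero k)
  have h2' : (2 : ℝ) ≤ n := by exact_mod_cast h2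
  have hk' : 2 * (n : ℝ) ≤ k := by exact_mod_cast hk
  have e : (zeta d).re = Real.cos (2 * Real.pi * n / k) := by
    rcases hd with rfl | rfl
    · exact zeta_natCast_re n
    · rw [zeta_neg, Complex.conj_re, zeta_natCast_re]
  rw [e]
  refine le_trans (Real.cos_le_cos_of_nonneg_of_le_pi (by positivity) ?_ ?_) hc
  · rw [div_le_iff₀ hk0]
    nlinarith [Real.pi_pos]
  · refine div_le_div_of_nonneg_right ?_ hk0.le
    nlinarith [Real.pi_pos]

/-- `C` and `S` are `cosh` and `sinh` of the inradius. For `k = 2 * m` the conditions `sub_eq_one`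
and `adjacent` give `C = cot (π / k)`, here `cot (π / 8) = 1 + √2`; likewise `cot (π / 12) = 2 + √3`
in degree twelve. -/
theorem isPolygon_eight : IsPolygon 8 (1 + √2) √(2 + 2 * √2) √2 := by
  have h2 : √2 ^ 2 = 2 := Real.sq_sqrt (by norm_num)
  have hp : 0 < √2 := by positivity
  have hS : √(2 + 2 * √2) ^ 2 = 2 + 2 * √2 := Real.sq_sqrt (by positivity)
  have h1 : (zeta (1 : ZMod 8)).re = √2 / 2 := by
    have := zeta_natCast_re (k := 8) 1
    rw [Nat.cast_one] at this
    rw [this, ← Real.cos_pi_div_four]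
    congr 1
    push_cast
    ring
  refine ⟨by positivity, by positivity, ?_, ?_, fun d hd0 hd1 hd2 => ?_⟩
  · rw [hS]; linear_combination h2
  · rw [h1, hS]; linear_combination (-2 - √2) * h2
  · have hn : ∀ d : ZMod 8, d ≠ 0 → d ≠ 1 → d ≠ -1 →
        ∃ n < 5, 2 ≤ n ∧ (d = (n : ℕ) ∨ d = -(n : ℕ)) := by decide
    obtain ⟨n, h5, hn2, h⟩ := hn d hd0 hd1 hd2
    have hre : (zeta d).re ≤ 0 := by
      refine zeta_re_le (le_of_eq ?_) ⟨n, hn2, by omega, h⟩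
      rw [← Real.cos_pi_div_two]
      congr 1
      push_cast
      ring
    rw [hS]
    nlinarith [mul_nonneg (sq_nonneg (1 + √2)) (neg_nonneg.2 hre)]

theorem isPolygon_twelve : IsPolygon 12 (2 + √3) √(6 + 4 * √3) √3 := by
  have h2 : √3 ^ 2 = 3 := Real.sq_sqrt (by norm_num)
  have hp : 0 < √3 := by positivity
  have hS : √(6 + 4 * √3) ^ 2 = 6 + 4 * √3 := Real.sq_sqrt (by positivity)
  have h1 : (zeta (1 : ZMod 12)).re = √3 / 2 := by
    have := zeta_natCast_re (k := 12) 1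
    rw [Nat.cast_one] at this
    rw [this, ← Real.cos_pi_div_six]
    congr 1
    push_cast
    ring
  refine ⟨by positivity, by positivity, ?_, ?_, fun d hd0 hd1 hd2 => ?_⟩
  · rw [hS]; linear_combination h2
  · rw [h1, hS]; linear_combination (-4 - √3) * h2
  · have hn : ∀ d : ZMod 12, d ≠ 0 → d ≠ 1 → d ≠ -1 →
        ∃ n < 7, 2 ≤ n ∧ (d = (n : ℕ) ∨ d = -(n : ℕ)) := by decide
    obtain ⟨n, h5, hn2, h⟩ := hn d hd0 hd1 hd2
    have hre : (zeta d).re ≤ 1 / 2 := by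
      refine zeta_re_le (le_of_eq ?_) ⟨n, hn2, by omega, h⟩
      rw [← Real.cos_pi_div_three]
      congr 1
      push_cast
      ring
    rw [hS]
    nlinarith [mul_nonneg (sq_nonneg (2 + √3)) (sub_nonneg.2 hre)]

/-- The values make `single` and `double` almost equalities; `base` has room to spare. The entry at
`0` and the default `1` serve only positivity. -/
theorem isAdmissibleWeight_eight : IsAdmissibleWeight 8 4
    (fun n => [1, 2.669371, 2.631394, 2.39234, 1.52199].getD n 1) (8 * 0.662816) where
  pos n := by
    rcases n with _ | _ | _ | _ | _ | n <;> norm_num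
  base := by norm_num
  single n h1 h2 := by interval_cases n <;> norm_num
  double := by norm_num

/-- Here only the `single` inequalities are nearly sharp; `base` and `double` are slack. -/
theorem isAdmissibleWeight_twelve : IsAdmissibleWeight 12 6
    (fun n => [1, 3.317, 3.3157, 3.3013, 3.1515, 2.1409, 0.6768].getD n 1) (12 * 0.552792) where
  pos n := by
    rcases n with _ | _ | _ | _ | _ | _ | _ | n <;> norm_num
  base := by norm_num
  single n h1 h2 := by interval_cases n <;> norm_num
  double := by norm_num

end Numerics

/-! ### Surface groups and their generators -/

section Surface

variable {g : ℕ}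

/-- The images of the generators `a_i` in the surface group. -/
def genA (i : Fin g) : SurfaceGroup g := PresentedGroup.of (Sum.inl i)

/-- The images of the generators `b_i` in the surface group. -/
def genB (i : Fin g) : SurfaceGroup g := PresentedGroup.of (Sum.inr i)

theorem prod_commutator_eq_one :
    (List.ofFn fun i : Fin g => genA i * genB i * (genA i)⁻¹ * (genB i)⁻¹).prod = 1 := by
  have h : PresentedGroup.mk ({surfaceRelator g} : Set (FreeGroup (Gen g))) (surfaceRelator g) = 1 :=
    PresentedGroup.one_of_mem (Set.mem_singleton _)
  have h2 := map_list_prod (PresentedGroup.mk ({surfaceRelator g} : Set (FreeGroup (Gen g))))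
    (List.ofFn fun i : Fin g => FreeGroup.of (Sum.inl i : Gen g) * FreeGroup.of (Sum.inr i : Gen g) *
      (FreeGroup.of (Sum.inl i : Gen g))⁻¹ * (FreeGroup.of (Sum.inr i : Gen g))⁻¹)
  rw [List.map_ofFn] at h2
  exact h2.symm.trans h

/-- The homomorphism from the surface group to a group determined by a solution of the relation. -/
def surfaceLift {G : Type*} [Group G] (a b : Fin g → G)
    (h : (List.ofFn fun i : Fin g => a i * b i * (a i)⁻¹ * (b i)⁻¹).prod = 1) :
    SurfaceGroup g →* G :=
  PresentedGroup.toGroup (f := Sum.elim a b) (rels := {surfaceRelator g}) (by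
    rintro r rfl
    rw [surfaceRelator, map_list_prod, List.map_ofFn]
    simpa [Function.comp_def] using h)

theorem surfaceLift_genA {G : Type*} [Group G] (a b : Fin g → G) (h) (i : Fin g) :
    surfaceLift a b h (genA i) = a i := PresentedGroup.toGroup.of _

theorem surfaceLift_genB {G : Type*} [Group G] (a b : Fin g → G) (h) (i : Fin g) :
    surfaceLift a b h (genB i) = b i := PresentedGroup.toGroup.of _

instance : Countable (SurfaceGroup g) :=
  (PresentedGroup.mk_surjective ({surfaceRelator g} : Set (FreeGroup (Gen g)))).countable

theorem closure_eq_top_of_range {ι : Type*} {s : ι → SurfaceGroup g}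
    (ha : ∀ i, genA i ∈ Set.range s) (hb : ∀ i, genB i ∈ Set.range s) :
    Subgroup.closure (Set.range s) = ⊤ := by
  rw [eq_top_iff, ← PresentedGroup.closure_range_of]
  refine Subgroup.closure_mono ?_
  rintro _ ⟨i | i, rfl⟩
  · exact ha i
  · exact hb i

theorem standardGenerators_eq_image {ι : Type*} [Fintype ι] {s : ι → SurfaceGroup g}
    (h : ∀ x, x ∈ Set.range s ↔ (∃ i, x = genA i ∨ x = (genA i)⁻¹) ∨ ∃ i, x = genB i ∨ x = (genB i)⁻¹) :
    ∀ x, x ∈ standardGenerators g ↔ x ∈ Set.range s := by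
  classical
  intro x
  rw [h]
  simp only [standardGenerators, Finset.mem_union, Finset.mem_image, Finset.mem_univ, true_and,
    Sum.exists, genA, genB, exists_or, eq_comm (a := x)]
  tauto

theorem sum_standardGenerators {ι : Type*} [Fintype ι] {s : ι → SurfaceGroup g}
    (hs : Function.Injective s) (h : ∀ x, x ∈ standardGenerators g ↔ x ∈ Set.range s) :
    (∀ F : SurfaceGroup g → ℂ, ∑ x ∈ standardGenerators g, F x = ∑ i, F (s i)) ∧
      (standardGenerators g).card = Fintype.card ι := by
  classical
  have e : standardGenerators g = Finset.univ.map ⟨s, hs⟩ := by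
    ext x
    simp [h]
  rw [e]
  exact ⟨fun F => Finset.sum_map _ _ _, Finset.card_map _⟩

theorem facePath_succ {Γ : Type*} [Group Γ] {k : ℕ} (s : ZMod k → Γ) (inv : ZMod k → ZMod k) (γ : Γ)
    (i : ZMod k) (m : ℕ) :
    facePath s inv γ i (m + 1) = facePath s inv (γ * s i) (inv i - 1) m := by
  induction m with
  | zero => rfl
  | succ m ih =>
    rw [facePath, ih, facePath, Function.iterate_succ_apply]

/-- By `h4` the face starting in direction `0` uses every direction, so each other face path is a
cyclic shift of a translate of that one. -/
theorem isCyclicOrder_of_facePath_zero {Γ : Type*} [Group Γ] {k : ℕ} [NeZero k] {s : ZMod k → Γ}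
    {inv : ZMod k → ZMod k} (h1 : ∀ i, inv (inv i) = i) (h2 : ∀ i, s (inv i) = (s i)⁻¹)
    (h3 : ∀ i, inv ((fun j => inv j - 1)^[k - 1] i) = i + 1)
    (h4 : ∀ i, ∃ n < k, (fun j => inv j - 1)^[n] 0 = i)
    (h5 : ∀ γ, facePath s inv γ 0 k = γ) : IsCyclicOrder s inv := by
  refine ⟨h1, h2, fun γ i => ?_, h3⟩
  have hper : ∀ i, (fun j => inv j - 1)^[k] i = i := fun i => by
    have e : (fun j => inv j - 1)^[k] i = (fun j => inv j - 1)^[k - 1 + 1] i :=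
      congrArg (fun n => (fun j => inv j - 1)^[n] i) (Nat.sub_add_cancel (Nat.pos_of_neZero k)).symm
    rw [e, Function.iterate_succ_apply', h3 i, add_sub_cancel_right]
  obtain ⟨n, -, rfl⟩ := h4 i
  induction n generalizing γ with
  | zero => exact h5 γ
  | succ n ih =>
    rw [Function.iterate_succ_apply']
    set j := (fun j => inv j - 1)^[n] 0
    have e1 := facePath_succ s inv (γ * (s j)⁻¹) j k
    rw [facePath, ih, hper, inv_mul_cancel_right] at e1
    exact e1.symm

end Surface

/-! ### Genus two and three -/

section Genus

variable {k : ℕ} [NeZero k] {C S σ : ℝ}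

theorem sidePairing_commutatorElement (hP : IsPolygon k C S σ) {i e i' e' : ZMod k}
    (h1 : e = 2 * i + 2) (h2 : i' = i + 3) (h3 : e' = 2 * i + 4) :
    sidePairing hP i e * sidePairing hP i' e' * (sidePairing hP i e)⁻¹ *
      (sidePairing hP i' e')⁻¹ =
    (wallReflection hP (i - 1 + 1) * wallReflection hP (i - 1)) ^ 2 *
      polygonRotation (-4 : ZMod k) := by
  rw [inv_eq_of_mul_eq_one_right (sidePairing_mul_sidePairing hP i e),
    inv_eq_of_mul_eq_one_right (sidePairing_mul_sidePairing hP i' e'), ← sidePairing_commutator,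
    h1, h2, h3]
  ring_nf

theorem polygonRotation_mul_sq (hP : IsPolygon k C S σ) (c i j : ZMod k) (h : j = i + c) :
    polygonRotation c * (wallReflection hP (i - 1 + 1) * wallReflection hP (i - 1)) ^ 2 =
      (wallReflection hP (j - 1 + 1) * wallReflection hP (j - 1)) ^ 2 * polygonRotation c := by
  have h1 : SemiconjBy (polygonRotation c)
      (wallReflection hP (i - 1 + 1) * wallReflection hP (i - 1))
      (wallReflection hP (j - 1 + 1) * wallReflection hP (j - 1)) := by
    rw [h, show i + c - 1 + 1 = i - 1 + 1 + c by ring, show i + c - 1 = i - 1 + c by ring]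
    exact SemiconjBy.mul_right (polygonRotation_mul_wallReflection hP c _)
      (polygonRotation_mul_wallReflection hP c _)
  exact h1.pow_right 2

/-- A homomorphism from the surface group to the integers separating the generators. -/
def surfaceWeight (g : ℕ) : SurfaceGroup g →* Multiplicative ℤ :=
  surfaceLift (fun i => Multiplicative.ofAdd (2 * (i : ℤ) + 1))
    (fun i => Multiplicative.ofAdd (2 * (i : ℤ) + 2)) (by
      refine (congrArg List.prod (congrArg List.ofFn (funext fun i => ?_))).trans
        (by simp : (List.ofFn fun _ : Fin g => (1 : Multiplicative ℤ)).prod = 1)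
      rw [mul_inv_cancel_comm, mul_inv_cancel])

/-- The generators of the surface group of genus two, in cyclic order. -/
def cyclicTwo : ZMod 8 → SurfaceGroup 2 :=
  ![genA 0, (genB 0)⁻¹, (genA 0)⁻¹, genB 0, genA 1, (genB 1)⁻¹, (genA 1)⁻¹, genB 1]

/-- The positions of the inverses in `cyclicTwo`. -/
def invTwo : ZMod 8 → ZMod 8 := ![2, 3, 0, 1, 6, 7, 4, 5]

/-- The generators of the surface group of genus three, in cyclic order. -/
def cyclicThree : ZMod 12 → SurfaceGroup 3 :=
  ![genA 0, (genB 0)⁻¹, (genA 0)⁻¹, genB 0, genA 1, (genB 1)⁻¹, (genA 1)⁻¹, genB 1,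
    genA 2, (genB 2)⁻¹, (genA 2)⁻¹, genB 2]

/-- The positions of the inverses in `cyclicThree`. -/
def invThree : ZMod 12 → ZMod 12 := ![2, 3, 0, 1, 6, 7, 4, 5, 10, 11, 8, 9]

theorem cyclicTwo_injective : Function.Injective cyclicTwo := by
  have hw : ∀ i : Fin 8, surfaceWeight 2 (cyclicTwo i) =
      Multiplicative.ofAdd ((![1, -2, -1, 2, 3, -4, -3, 4] : Fin 8 → ℤ) i) := fun i => by
    fin_cases i <;> simp [cyclicTwo, surfaceWeight, surfaceLift_genA, surfaceLift_genB, ← ofAdd_neg] <;>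
      rfl
  have hinj : Function.Injective (![1, -2, -1, 2, 3, -4, -3, 4] : Fin 8 → ℤ) := by decide
  intro i j h
  have := congrArg (surfaceWeight 2) h
  rw [hw i, hw j] at this
  exact hinj (Multiplicative.ofAdd.injective this)

theorem cyclicThree_injective : Function.Injective cyclicThree := by
  have hw : ∀ i : Fin 12, surfaceWeight 3 (cyclicThree i) =
      Multiplicative.ofAdd ((![1, -2, -1, 2, 3, -4, -3, 4, 5, -6, -5, 6] : Fin 12 → ℤ) i) :=
    fun i => by
    fin_cases i <;>
      simp [cyclicThree, surfaceWeight, surfaceLift_genA, surfaceLift_genB, ← ofAdd_neg] <;>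
      rfl
  have hinj : Function.Injective
      (![1, -2, -1, 2, 3, -4, -3, 4, 5, -6, -5, 6] : Fin 12 → ℤ) := by decide
  intro i j h
  have := congrArg (surfaceWeight 3) h
  rw [hw i, hw j] at this
  exact hinj (Multiplicative.ofAdd.injective this)

theorem mem_standardGenerators_two (x : SurfaceGroup 2) :
    x ∈ standardGenerators 2 ↔ x ∈ Set.range cyclicTwo := by
  refine standardGenerators_eq_image (fun x => ?_) x
  change (∃ i : Fin 8, cyclicTwo i = x) ↔ _
  simp [cyclicTwo, Fin.exists_fin_succ, eq_comm (b := x)]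
  tauto

theorem mem_standardGenerators_three (x : SurfaceGroup 3) :
    x ∈ standardGenerators 3 ↔ x ∈ Set.range cyclicThree := by
  refine standardGenerators_eq_image (fun x => ?_) x
  change (∃ i : Fin 12, cyclicThree i = x) ↔ _
  simp [cyclicThree, Fin.exists_fin_succ, eq_comm (b := x)]
  tauto

theorem isCyclicOrder_two : IsCyclicOrder cyclicTwo invTwo := by
  refine isCyclicOrder_of_facePath_zero (by decide) (fun i => ?_) (by decide) (by decide) fun γ => ?_
  · change Fin 8 at i
    fin_cases i <;> rfl
  -- The word read along the face is a cyclic rotation of the inverse relator.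
  · have h := prod_commutator_eq_one (g := 2)
    simp only [List.ofFn_succ, List.ofFn_zero, List.prod_cons, List.prod_nil, mul_one] at h
    change γ * genA 0 * (genB 0)⁻¹ * (genA 0)⁻¹ * genB 1 * genA 1 * (genB 1)⁻¹ * (genA 1)⁻¹ *
      genB 0 = γ
    change genA 0 * genB 0 * (genA 0)⁻¹ * (genB 0)⁻¹ *
      (genA 1 * genB 1 * (genA 1)⁻¹ * (genB 1)⁻¹) = 1 at h
    rw [mul_eq_one_iff_eq_inv] at h
    have e : γ * genA 0 * (genB 0)⁻¹ * (genA 0)⁻¹ * genB 1 * genA 1 * (genB 1)⁻¹ * (genA 1)⁻¹ *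
        genB 0 = γ * genA 0 * (genB 0)⁻¹ * (genA 0)⁻¹ *
          (genA 1 * genB 1 * (genA 1)⁻¹ * (genB 1)⁻¹)⁻¹ * genB 0 := by group
    rw [e, ← h]
    group

theorem isCyclicOrder_three : IsCyclicOrder cyclicThree invThree := by
  refine isCyclicOrder_of_facePath_zero (by decide) (fun i => ?_) (by decide) (by decide) fun γ => ?_
  · change Fin 12 at i
    fin_cases i <;> rfl
  · have h := prod_commutator_eq_one (g := 3)
    simp only [List.ofFn_succ, List.ofFn_zero, List.prod_cons, List.prod_nil, mul_one] at h
    change γ * genA 0 * (genB 0)⁻¹ * (genA 0)⁻¹ * genB 2 * genA 2 * (genB 2)⁻¹ * (genA 2)⁻¹ *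
      genB 1 * genA 1 * (genB 1)⁻¹ * (genA 1)⁻¹ * genB 0 = γ
    change genA 0 * genB 0 * (genA 0)⁻¹ * (genB 0)⁻¹ *
      (genA 1 * genB 1 * (genA 1)⁻¹ * (genB 1)⁻¹ *
        (genA 2 * genB 2 * (genA 2)⁻¹ * (genB 2)⁻¹)) = 1 at h
    rw [mul_eq_one_iff_eq_inv] at h
    have e : γ * genA 0 * (genB 0)⁻¹ * (genA 0)⁻¹ * genB 2 * genA 2 * (genB 2)⁻¹ * (genA 2)⁻¹ *
        genB 1 * genA 1 * (genB 1)⁻¹ * (genA 1)⁻¹ * genB 0 = γ * genA 0 * (genB 0)⁻¹ * (genA 0)⁻¹ *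
          (genA 1 * genB 1 * (genA 1)⁻¹ * (genB 1)⁻¹ *
            (genA 2 * genB 2 * (genA 2)⁻¹ * (genB 2)⁻¹))⁻¹ * genB 0 := by group
    rw [e, ← h]
    group

theorem closure_range_cyclicTwo : Subgroup.closure (Set.range cyclicTwo) = ⊤ := by
  refine closure_eq_top_of_range (fun i => ?_) (fun i => ?_) <;>
    rw [← mem_standardGenerators_two] <;>
    simp [standardGenerators, genA, genB]

theorem closure_range_cyclicThree : Subgroup.closure (Set.range cyclicThree) = ⊤ := by
  refine closure_eq_top_of_range (fun i => ?_) (fun i => ?_) <;>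
    rw [← mem_standardGenerators_three] <;>
    simp [standardGenerators, genA, genB]

theorem exists_polygon_action_two : ∃ ρ : SurfaceGroup 2 →* ((ℂ × ℝ) ≃ₗ[ℝ] (ℂ × ℝ)),
    ∀ i, ρ (cyclicTwo i) = sidePairing isPolygon_eight i (i + invTwo i) := by
  refine ⟨surfaceLift ![sidePairing isPolygon_eight 0 2, sidePairing isPolygon_eight 4 2]
    ![sidePairing isPolygon_eight 3 4, sidePairing isPolygon_eight 7 4] ?_, fun i => ?_⟩
  · simp only [List.ofFn_succ, List.ofFn_zero, List.prod_cons, List.prod_nil, mul_one]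
    have e1 := sidePairing_commutatorElement isPolygon_eight (i := 0) (e := 2) (i' := 3) (e' := 4)
      (by decide) (by decide) (by decide)
    have e2 := sidePairing_commutatorElement isPolygon_eight (i := 4) (e := 2) (i' := 7) (e' := 4)
      (by decide) (by decide) (by decide)
    -- Each commutator is the square of a vertex rotation times the polygon rotation by `-4`. Moving
    -- the latter to the right makes the squares equal: what remains is the fourth power of one
    -- vertex rotation, which is `1`, and the polygon rotation by `-8 = 0`.
    refine (congrArg₂ (· * ·) e1 e2).trans ?_
    rw [mul_assoc, ← mul_assoc (polygonRotation (-4)),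
      polygonRotation_mul_sq isPolygon_eight (-4) 4 0 (by decide), ← mul_assoc, ← mul_assoc,
      ← pow_add, mul_assoc, polygonRotation_mul_polygonRotation,
      show (-4 + -4 : ZMod 8) = 0 by decide, polygonRotation_zero, mul_one]
    exact wallReflection_mul_pow_four isPolygon_eight (Real.sq_sqrt (by norm_num)) _
  · change Fin 8 at i
    have hinv : ∀ i e : ZMod 8, (sidePairing isPolygon_eight i e)⁻¹ =
        sidePairing isPolygon_eight (e - i) e := fun i e =>
      inv_eq_of_mul_eq_one_right (sidePairing_mul_sidePairing isPolygon_eight i e)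
    fin_cases i <;>
      simp [cyclicTwo, surfaceLift_genA, surfaceLift_genB, hinv] <;> congr 1

theorem exists_polygon_action_three : ∃ ρ : SurfaceGroup 3 →* ((ℂ × ℝ) ≃ₗ[ℝ] (ℂ × ℝ)),
    ∀ i, ρ (cyclicThree i) = sidePairing isPolygon_twelve i (i + invThree i) := by
  refine ⟨surfaceLift ![sidePairing isPolygon_twelve 0 2, sidePairing isPolygon_twelve 4 10,
      sidePairing isPolygon_twelve 8 6]
    ![sidePairing isPolygon_twelve 3 4, sidePairing isPolygon_twelve 7 0,
      sidePairing isPolygon_twelve 11 8] ?_, fun i => ?_⟩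
  · simp only [List.ofFn_succ, List.ofFn_zero, List.prod_cons, List.prod_nil, mul_one]
    have e1 := sidePairing_commutatorElement isPolygon_twelve (i := 0) (e := 2) (i' := 3) (e' := 4)
      (by decide) (by decide) (by decide)
    have e2 := sidePairing_commutatorElement isPolygon_twelve (i := 4) (e := 10) (i' := 7)
      (e' := 0) (by decide) (by decide) (by decide)
    have e3 := sidePairing_commutatorElement isPolygon_twelve (i := 8) (e := 6) (i' := 11)
      (e' := 8) (by decide) (by decide) (by decide)
    refine (congrArg₂ (· * ·) e1 (congrArg₂ (· * ·) e2 e3)).trans ?_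
    have c1 := polygonRotation_mul_sq isPolygon_twelve (-4) 4 0 (by decide)
    have c2 := polygonRotation_mul_sq isPolygon_twelve (-4) 8 4 (by decide)
    have c3 : polygonRotation (-4 : ZMod 12) * (polygonRotation (-4 : ZMod 12) *
        polygonRotation (-4 : ZMod 12)) = 1 := by
      rw [polygonRotation_mul_polygonRotation, polygonRotation_mul_polygonRotation,
        show (-4 + (-4 + -4) : ZMod 12) = 0 by decide, polygonRotation_zero]
    have c4 := wallReflection_mul_pow_six isPolygon_twelve (Real.sq_sqrt (by norm_num)) (0 - 1)
    generalize wallReflection isPolygon_twelve (0 - 1 + 1) *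
      wallReflection isPolygon_twelve (0 - 1) = X at c1 c4 ⊢
    generalize (wallReflection isPolygon_twelve (4 - 1 + 1) *
      wallReflection isPolygon_twelve (4 - 1)) ^ 2 = Y at c1 c2 ⊢
    generalize (wallReflection isPolygon_twelve (8 - 1 + 1) *
      wallReflection isPolygon_twelve (8 - 1)) ^ 2 = Z at c2 ⊢
    generalize polygonRotation (-4 : ZMod 12) = R at c1 c2 c3 ⊢
    -- As in genus two: `c1` and `c2` turn `Y` and `Z` into `X ^ 2` while the copies of `R` move
    -- right and combine to the rotation by `-12 = 0`.
    calc X ^ 2 * R * (Y * R * (Z * R)) = X ^ 2 * (R * Y) * (R * Z) * R := by group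
      _ = X ^ 2 * (X ^ 2 * R) * (Y * R) * R := by rw [c1, c2]
      _ = X ^ 4 * (R * Y) * R * R := by group
      _ = X ^ 4 * (X ^ 2 * R) * R * R := by rw [c1]
      _ = X ^ 6 * (R * (R * R)) := by simp only [mul_assoc, ← mul_assoc (X ^ 4), ← pow_add]
      _ = 1 := by rw [c3, c4, mul_one]
  · change Fin 12 at i
    have hinv : ∀ i e : ZMod 12, (sidePairing isPolygon_twelve i e)⁻¹ =
        sidePairing isPolygon_twelve (e - i) e := fun i e =>
      inv_eq_of_mul_eq_one_right (sidePairing_mul_sidePairing isPolygon_twelve i e)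
    fin_cases i <;>
      simp [cyclicThree, surfaceLift_genA, surfaceLift_genB, hinv] <;> congr 1

end Genus

end SurfaceWalk

end

open SurfaceWalk in
theorem mainTheorem3 :
    (0.662418 ≤ ‖SurfaceWalk.surfaceMarkov 2‖ ∧ ‖SurfaceWalk.surfaceMarkov 2‖ ≤ 0.662816) ∧
      (0.552773 ≤ ‖SurfaceWalk.surfaceMarkov 3‖ ∧ ‖SurfaceWalk.surfaceMarkov 3‖ ≤ 0.552792) := by
  obtain ⟨hA2, hc2⟩ := sum_standardGenerators cyclicTwo_injective mem_standardGenerators_two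
  obtain ⟨hA3, hc3⟩ := sum_standardGenerators cyclicThree_injective mem_standardGenerators_three
  refine ⟨⟨?_, ?_⟩, ?_, ?_⟩
  · by_contra hcon
    obtain ⟨h, hpos, hsup⟩ := exists_superharmonic_of_norm_markovOperator_lt hA2 hc2 invTwo
      isCyclicOrder_two.map_inv closure_range_cyclicTwo (not_le.1 hcon)
    refine not_superharmonic_eight isCyclicOrder_two hpos fun γ => (hsup γ).trans_eq ?_
    rw [ZMod.card]
    norm_num
  · obtain ⟨ρ, hρ⟩ := exists_polygon_action_two
    refine (norm_markovOperator_le_of_polygon isPolygon_eight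
      (isDihedralCount_four (by positivity) (Real.sq_sqrt (by norm_num))) isAdmissibleWeight_eight
      (by norm_num) (by decide) (by decide) (by decide) hA2 (hc2.trans (ZMod.card 8)) invTwo
      isCyclicOrder_two.invol isCyclicOrder_two.map_inv closure_range_cyclicTwo ρ hρ).trans ?_
    norm_num
  · by_contra hcon
    obtain ⟨h, hpos, hsup⟩ := exists_superharmonic_of_norm_markovOperator_lt hA3 hc3 invThree
      isCyclicOrder_three.map_inv closure_range_cyclicThree (not_le.1 hcon)
    refine not_superharmonic_twelve isCyclicOrder_three hpos fun γ => (hsup γ).trans_eq ?_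
    rw [ZMod.card]
    norm_num
  · obtain ⟨ρ, hρ⟩ := exists_polygon_action_three
    refine (norm_markovOperator_le_of_polygon isPolygon_twelve
      (isDihedralCount_six (by positivity) (Real.sq_sqrt (by norm_num))) isAdmissibleWeight_twelve
      (by norm_num) (by decide) (by decide) (by decide) hA3 (hc3.trans (ZMod.card 12)) invThree
      isCyclicOrder_three.invol isCyclicOrder_three.map_inv closure_range_cyclicThree ρ hρ).trans ?_
    norm_num
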